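/- Let $\beta,R>0$ with $\beta R<1$, and let $u:[0,\infty)\to\mathbb R\cup\{-\infty\}$ be finite and twice continuously differentiable on $(0,\infty)$ with $u'>0$, $u''<0$, $u'(0+)=\infty$, $u'(\infty)=0$ and $u(0)\le u(x)$ for all $x>0$. Let $\gamma(x)=-xu''(x)/u'(x)$ and assume $\bar\gamma:=\limsup_{x\to\infty}\gamma(x)<\infty$. Let $(z_t)_{t\ge0}$ be a Markov process on a measurable space $Z$ with respect to a filtration $(\mathcal F_t)$, and let income be $y_t=y(z_t)\ge 0$, where $y:Z\to[0,\infty)$ is measurable and $\sup_{z\in Z}E[y(z_{t+1})\mid z_t=z]$ is bounded uniformly in $t$. Given a constant initial wealth $a_0>0$, the income fluctuation problem is to maximize $$E\sum_{t=0}^\infty\beta^tu(c_t)\quad\text{subject to}\quad a_{t+1}=R(a_t-c_t)+y_{t+1},\qquad 0\le c_t\le a_t,$$ over adapted consumption plans $(c_t)$. If $R=1$, assume moreover that the problem without income has finite value, that is, that there are $d_t>0$ with $\sum_t d_t<\infty$ and $\sum_t\beta^t|u(d_t)|<\infty$. (i) There is $\rho\in(0,1)$ with the following contraction property: there is $A\ge0$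 such that for every $a_0>0$ and every solution of the income fluctuation problem with initial wealth $a_0$, almost surely, for all $t\ge 0$, $$a_t\ge A\ \Longrightarrow\ a_{t+1}\le\rho a_t+y_{t+1}.$$ If $R<1$, one can take $\rho=R$. If $R\ge1$, one can take any $\rho\in((\beta R)^{1/\bar\gamma},1)$, where $(\beta R)^{1/\bar\gamma}$ is read as $0$ when $\bar\gamma=0$. (ii) Consequently, let $(a_t)_{t\ge0}$ be the wealth process of a solution with initial wealth $a_0>0$. If $(y_t)_{t\ge1}$ is uniformly light-tailed, i.e. $\sup_{t\ge 1}E[e^{sy_t}]<\infty$ for some $s>0$, then so is $(a_t)_{t\ge0}$. If $(y_t)_{t\ge1}$ has polynomial decay rate $\alpha=\sup\{s\ge0:\sup_{t\ge 1}E[y_t^s]<\infty\}\in[0,\infty]$, then the polynomial decay rate $\alpha'$ of $(a_t)_{t\ge0}$ satisfies $\alpha'\ge\alpha$. -/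

import Mathlib

open Filter Topology MeasureTheory ProbabilityTheory
open scoped ENNReal

namespace IncomeFluctuation

noncomputable section

/-! ### Utility -/

/-- The real-valued version of a utility function `u : [0, ∞) → {-∞} ∪ ℝ` (values of `u` at
negative arguments are never used). -/
def realUtility (u : ℝ → EReal) : ℝ → ℝ := fun x => (u x).toReal

/-- Marginal utility `u'`. -/
def marginal (u : ℝ → EReal) : ℝ → ℝ := deriv (realUtility u)

/-- Standard assumptions on the utility function: finite and twice continuously differentiable on
`(0, ∞)` with `u' > 0`, `u'' < 0`, `u'(0) = ∞`, `u'(∞) = 0`; at zero consumption the utility is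
allowed to be `-∞` and does not exceed the utility of positive consumption. -/
structure UtilityAssumption (u : ℝ → EReal) : Prop where
  finite : ∀ x, 0 < x → u x ≠ ⊥ ∧ u x ≠ ⊤
  zero_le : ∀ x, 0 < x → u 0 ≤ u x
  contDiffOn : ContDiffOn ℝ 2 (realUtility u) (Set.Ioi 0)
  marginal_pos : ∀ x, 0 < x → 0 < marginal u x
  deriv_marginal_neg : ∀ x, 0 < x → deriv (marginal u) x < 0
  marginal_zero : Tendsto (marginal u) (𝓝[>] 0) atTop
  marginal_top : Tendsto (marginal u) atTop (𝓝 0)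

/-- Local relative risk aversion `γ(x) = -x u''(x) / u'(x)`. -/
def riskAversion (u : ℝ → EReal) (x : ℝ) : ℝ := -(x * deriv (marginal u) x) / marginal u x

/-- `limsup_{x → ∞} γ(x)`, as an extended real number. -/
def limsupRiskAversion (u : ℝ → EReal) : EReal :=
  limsup (fun x : ℝ => (riskAversion u x : EReal)) atTop

/-- Asymptotically bounded relative risk aversion. -/
def BoundedRiskAversion (u : ℝ → EReal) : Prop := limsupRiskAversion u < ⊤

/-- The asymptotic relative risk aversion coefficient `γ̄`. -/
def asymptoticRiskAversion (u : ℝ → EReal) : ℝ := (limsupRiskAversion u).toReal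

/-- The number `(βR)^(1/γ̄)`, which for `βR < 1` is read as `0` when `γ̄ = 0`. -/
def contractionBound (u : ℝ → EReal) (β R : ℝ) : ℝ :=
  if asymptoticRiskAversion u = 0 then 0 else (β * R) ^ (1 / asymptoticRiskAversion u)

/-- The consumption-saving problem without any income has a plan with finite lifetime utility:
some positive deterministic consumption sequence has finite present value at the rate `R` and
finite discounted utility. -/
def FiniteValueWithoutIncome (u : ℝ → EReal) (β R : ℝ) : Prop :=
  ∃ d : ℕ → ℝ, (∀ t, 0 < d t) ∧ Summable (fun t => d t / R ^ t) ∧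
    Summable (fun t => β ^ t * realUtility u (d t))

/-! ### Income -/

section Processes

variable {Ω Z : Type*} {mΩ : MeasurableSpace Ω} [MeasurableSpace Z]

/-- `z` is a Markov process for the filtration `ℱ` under `P`, with transition kernels `κ t` (from
period `t` to period `t + 1`). -/
def IsMarkovProcess (P : Measure Ω) (ℱ : Filtration ℕ mΩ) (κ : ℕ → Kernel Z Z)
    (z : ℕ → Ω → Z) : Prop :=
  Adapted ℱ z ∧ ∀ (t : ℕ) (B : Set Z), MeasurableSet B →
    P⟦z (t + 1) ⁻¹' B | ℱ t⟧ =ᵐ[P] fun ω => (κ t (z t ω)).real B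

/-- The conditional mean of next period's income is bounded uniformly over states (and dates). -/
def BoundedConditionalMean (κ : ℕ → Kernel Z Z) (y : Z → ℝ) : Prop :=
  (⨆ (t : ℕ) (s : Z), ∫⁻ s', ENNReal.ofReal (y s') ∂(κ t s)) < ⊤

/-! ### The income fluctuation problem -/

/-- Wealth: `a 0 = a₀` and `a (t + 1) = R * (a t - c t) + y (z (t + 1))`. -/
def wealth (R a₀ : ℝ) (y : Z → ℝ) (z : ℕ → Ω → Z) (c : ℕ → Ω → ℝ) : ℕ → Ω → ℝ
  | 0, _ => a₀
  | t + 1, ω => R * (wealth R a₀ y z c t ω - c t ω) + y (z (t + 1) ω)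

/-- Feasible consumption plans: adapted, with `0 ≤ c t ≤ a t` almost surely. -/
def IsFeasible (P : Measure Ω) (ℱ : Filtration ℕ mΩ) (R a₀ : ℝ) (y : Z → ℝ) (z : ℕ → Ω → Z)
    (c : ℕ → Ω → ℝ) : Prop :=
  Adapted ℱ c ∧ ∀ t, ∀ᵐ ω ∂P, 0 ≤ c t ω ∧ c t ω ≤ wealth R a₀ y z c t ω

/-- Expected lifetime utility `E ∑ β^t u(c t)`, as the integral of the positive part minus the
integral of the negative part (and `-∞` if both are infinite). -/
def lifetimeUtility (P : Measure Ω) (u : ℝ → EReal) (β : ℝ) (c : ℕ → Ω → ℝ) : EReal :=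
  ((∫⁻ ω, ∑' t, ENNReal.ofReal (β ^ t) * (u (c t ω)).toENNReal ∂P : ℝ≥0∞) : EReal) -
    ((∫⁻ ω, ∑' t, ENNReal.ofReal (β ^ t) * (-(u (c t ω))).toENNReal ∂P : ℝ≥0∞) : EReal)

/-- `c` solves the income fluctuation problem with initial wealth `a₀`. -/
def IsSolution (P : Measure Ω) (ℱ : Filtration ℕ mΩ) (u : ℝ → EReal) (β R a₀ : ℝ) (y : Z → ℝ)
    (z : ℕ → Ω → Z) (c : ℕ → Ω → ℝ) : Prop :=
  IsFeasible P ℱ R a₀ y z c ∧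
    ∀ c', IsFeasible P ℱ R a₀ y z c' → lifetimeUtility P u β c' ≤ lifetimeUtility P u β c

/-- The contraction property with coefficient `ρ` at high wealth levels: there is a threshold `A`,
common to all initial wealth levels, such that optimal wealth almost surely satisfies
`a (t + 1) ≤ ρ * a t + y (z (t + 1))` whenever `a t ≥ A`. -/
def ContractionProperty (P : Measure Ω) (ℱ : Filtration ℕ mΩ) (u : ℝ → EReal) (β R : ℝ)
    (y : Z → ℝ) (z : ℕ → Ω → Z) (ρ : ℝ) : Prop :=
  ∃ A : ℝ, 0 ≤ A ∧ ∀ (a₀ : ℝ) (c : ℕ → Ω → ℝ), 0 < a₀ → IsSolution P ℱ u β R a₀ y z c →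
    ∀ᵐ ω ∂P, ∀ t, A ≤ wealth R a₀ y z c t ω →
      wealth R a₀ y z c (t + 1) ω ≤ ρ * wealth R a₀ y z c t ω + y (z (t + 1) ω)

/-! ### Tails of families of random variables -/

/-- `(X i)` is uniformly light-tailed: `sup_i E[exp (s * X i)] < ∞` for some `s > 0`. -/
def UniformlyLightTailed {ι : Type*} (P : Measure Ω) (X : ι → Ω → ℝ) : Prop :=
  ∃ s : ℝ, 0 < s ∧ (⨆ i, ∫⁻ ω, ENNReal.ofReal (Real.exp (s * X i ω)) ∂P) < ⊤

/-- Polynomial decay rate of `(X i)`: the supremum in `[0, ∞]` of all `s ≥ 0` such that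
`sup_i E[(X i)₊ ^ s] < ∞`. -/
def polynomialDecayRate {ι : Type*} (P : Measure Ω) (X : ι → Ω → ℝ) : ℝ≥0∞ :=
  sSup {r : ℝ≥0∞ | ∃ s : ℝ, 0 ≤ s ∧ r = ENNReal.ofReal s ∧
    (⨆ i, ∫⁻ ω, ENNReal.ofReal ((max (X i ω) 0) ^ s) ∂P) < ⊤}

end Processes

end

end IncomeFluctuation

namespace IncomeFluctuation

/-! If `R < 1`, the budget constraint with `c ≥ 0` already gives the contraction with `ρ = R`. If `R
≥ 1`, contraction with coefficient `ρ` amounts to `c t ≥ k * a t` with `k = 1 - ρ / R` at high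
wealth, and this comes from a variational argument.

Suppose consumption is below `x < q` on an event where wealth is at least `q / k`. Let the agent
consume `q` instead and repay the debt later, whenever the original consumption exceeds a reference
path `e` with `e 0 = q` and `(βR)^n u'(e n) ≤ u'(q)`. The present value of the repayments is at most
the amount borrowed, and each unit of it costs at most `β^t u'(q)`, so strict concavity leaves a
strict gain (`UtilityAssumption.utility_deviation`). The deviation is feasible if current wealth
alone finances `e` (`deviation_feasible`), so by optimality the event is null
(`IsSolution.measure_eq_zero`).

The path shrinks by a factor `ρ' < ρ` per period while consumption is large: bounded risk aversion
keeps the growth of `u'` below `1 / (βR)` (`exists_marginal_mul_le`). From a bounded level on it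
continues at bounded cost `K`. Its total cost `K + q / (1 - ρ' / R)` is below `q / k` for large `q`.

Below the threshold wealth is bounded, so `a (t + 1) ≤ ρ * a t + B + y (t + 1)` always holds.
Convexity (or subadditivity, for powers below one) turns this into a contraction of exponential or
power moments. -/

theorem contractionBound_nonneg {u : ℝ → EReal} {β R : ℝ} (h0 : 0 < β * R) :
    0 ≤ contractionBound u β R := by
  unfold contractionBound
  split_ifs
  · rfl
  · positivity

/-! ### Concavity, tangent lines and asymptotic risk aversion -/

namespace UtilityAssumption

variable {u : ℝ → EReal}

theorem coe_realUtility (hu : UtilityAssumption u) {x : ℝ} (hx : 0 < x) :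
    ((realUtility u x : ℝ) : EReal) = u x :=
  EReal.coe_toReal (hu.finite x hx).2 (hu.finite x hx).1

theorem differentiableAt (hu : UtilityAssumption u) {x : ℝ} (hx : 0 < x) :
    DifferentiableAt ℝ (realUtility u) x :=
  differentiableAt_of_deriv_ne_zero (hu.marginal_pos x hx).ne'

theorem differentiableAt_marginal (hu : UtilityAssumption u) {x : ℝ} (hx : 0 < x) :
    DifferentiableAt ℝ (marginal u) x :=
  differentiableAt_of_deriv_ne_zero (hu.deriv_marginal_neg x hx).ne

theorem strictMonoOn (hu : UtilityAssumption u) :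
    StrictMonoOn (realUtility u) (Set.Ioi 0) :=
  strictMonoOn_of_deriv_pos (convex_Ioi 0)
    (fun _ hx => (hu.differentiableAt hx).continuousAt.continuousWithinAt)
    (fun x hx => hu.marginal_pos x (by simpa using hx))

theorem marginal_strictAntiOn (hu : UtilityAssumption u) :
    StrictAntiOn (marginal u) (Set.Ioi 0) :=
  strictAntiOn_of_deriv_neg (convex_Ioi 0)
    (fun _ hx => (hu.differentiableAt_marginal hx).continuousAt.continuousWithinAt)
    (fun x hx => hu.deriv_marginal_neg x (by simpa using hx))

theorem strictConcaveOn (hu : UtilityAssumption u) :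
    StrictConcaveOn ℝ (Set.Ioi 0) (realUtility u) := by
  refine StrictAntiOn.strictConcaveOn_of_deriv (convex_Ioi 0)
    (fun _ hx => (hu.differentiableAt hx).continuousAt.continuousWithinAt) ?_
  rw [interior_Ioi]
  exact hu.marginal_strictAntiOn

theorem lt_tangent (hu : UtilityAssumption u) {x y : ℝ} (hx : 0 < x) (hy : 0 < y) (hxy : x ≠ y) :
    realUtility u y < realUtility u x + marginal u x * (y - x) := by
  rcases lt_or_gt_of_ne hxy with h | h
  · have := hu.strictConcaveOn.slope_lt_deriv (x := x) (y := y) hx hy h (hu.differentiableAt hx)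
    rw [slope_def_field, div_lt_iff₀ (by linarith)] at this
    change _ < marginal u x * _ at this
    linarith
  · have := hu.strictConcaveOn.deriv_lt_slope (x := y) (y := x) hy hx h (hu.differentiableAt hx)
    rw [slope_def_field, lt_div_iff₀ (by linarith)] at this
    change marginal u x * _ < _ at this
    nlinarith

theorem le_tangent (hu : UtilityAssumption u) {x y : ℝ} (hx : 0 < x) (hy : 0 < y) :
    realUtility u y ≤ realUtility u x + marginal u x * (y - x) := by
  rcases eq_or_ne x y with rfl | h
  · simp
  · exact (hu.lt_tangent hx hy h).le

theorem ne_top (hu : UtilityAssumption u) {x : ℝ} (hx : 0 ≤ x) : u x ≠ ⊤ := by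
  rcases hx.eq_or_lt with rfl | h
  · intro h0
    have := hu.zero_le 1 one_pos
    rw [h0, top_le_iff] at this
    exact (hu.finite 1 one_pos).2 this
  · exact (hu.finite x h).2

/-- The boundary point follows by letting `z → 0+` in `u 0 ≤ u z`, so the bound survives `u 0 = -∞`
and needs no continuity of `u` at `0`. -/
theorem le_coe_tangent (hu : UtilityAssumption u) {x y : ℝ} (hx : 0 < x) (hy : 0 ≤ y) :
    u y ≤ ((realUtility u x + marginal u x * (y - x) : ℝ) : EReal) := by
  rcases hy.eq_or_lt with rfl | h
  · have key : ∀ z : ℝ, 0 < z →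
        u 0 ≤ ((realUtility u x + marginal u x * (z - x) : ℝ) : EReal) := fun z hz =>
      (hu.zero_le z hz).trans (by
        rw [← hu.coe_realUtility hz]
        exact EReal.coe_le_coe_iff.2 (hu.le_tangent hx hz))
    have hlim : Tendsto (fun z : ℝ => ((realUtility u x + marginal u x * (z - x) : ℝ) : EReal))
        (𝓝[>] 0) (𝓝 ((realUtility u x + marginal u x * (0 - x) : ℝ) : EReal)) := by
      refine (continuous_coe_real_ereal.tendsto _).comp ?_
      refine Tendsto.mono_left ?_ nhdsWithin_le_nhds
      exact Continuous.tendsto (by fun_prop) 0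
    exact ge_of_tendsto hlim (eventually_nhdsWithin_of_forall key)
  · rw [← hu.coe_realUtility h]
    exact EReal.coe_le_coe_iff.2 (hu.le_tangent hx h)

/-- Truncation is needed because `u` is arbitrary on negative arguments; monotonicity then supplies
measurability of `u ∘ c`. -/
theorem monotone_max (hu : UtilityAssumption u) : Monotone fun x => u (max x 0) := by
  intro x y hxy
  rcases le_or_gt x 0 with hx | hx
  · rcases le_or_gt y 0 with hy | hy
    · simp [hx, hy]
    · simpa [hx, hy.le] using hu.zero_le y hy
  · have hy := hx.trans_le hxy
    simp only [max_eq_left hx.le, max_eq_left hy.le]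
    rw [← hu.coe_realUtility hx, ← hu.coe_realUtility hy]
    exact EReal.coe_le_coe_iff.2 (hu.strictMonoOn.monotoneOn hx hy hxy)

theorem limsup_nonneg (hu : UtilityAssumption u) : 0 ≤ limsupRiskAversion u := by
  refine le_limsup_of_frequently_le (Eventually.frequently ?_)
  filter_upwards [eventually_gt_atTop (0 : ℝ)] with x hx
  have h1 := hu.marginal_pos x hx
  have h2 := hu.deriv_marginal_neg x hx
  exact_mod_cast div_nonneg (by nlinarith) h1.le

theorem asymptoticRiskAversion_nonneg (hu : UtilityAssumption u) :
    0 ≤ asymptoticRiskAversion u := EReal.toReal_nonneg hu.limsup_nonneg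

theorem contractionBound_lt_one (hu : UtilityAssumption u) {β R : ℝ} (h0 : 0 < β * R)
    (h1 : β * R < 1) : contractionBound u β R < 1 := by
  unfold contractionBound
  split_ifs with h
  · exact one_pos
  · have := hu.asymptoticRiskAversion_nonneg.lt_of_ne' h
    exact Real.rpow_lt_one h0.le h1 (by positivity)

theorem eventually_riskAversion_lt (hu : UtilityAssumption u) (hb : BoundedRiskAversion u) {g : ℝ}
    (hg : asymptoticRiskAversion u < g) : ∀ᶠ x in atTop, riskAversion u x < g := by
  have h : limsupRiskAversion u < (g : EReal) := by
    have h0 : limsupRiskAversion u ≠ ⊥ :=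
      fun h => by simpa [h] using hu.limsup_nonneg
    rw [← EReal.coe_toReal hb.ne h0]
    exact EReal.coe_lt_coe_iff.2 hg
  filter_upwards [eventually_lt_of_limsup_lt h] with x hx
  exact_mod_cast hx

/-- Above the contraction bound, shrinking a large consumption level by the factor `ρ` raises
marginal utility by a factor of at most `1 / (β R)`. -/
theorem exists_marginal_mul_le (hu : UtilityAssumption u) (hb : BoundedRiskAversion u) {β R ρ : ℝ}
    (h0 : 0 < β * R) (h1 : β * R < 1) (hρ : contractionBound u β R < ρ) (hρ1 : ρ < 1) :
    ∃ x₀ : ℝ, 0 < x₀ ∧ ∀ x, x₀ ≤ x → β * R * marginal u (ρ * x) ≤ marginal u x := by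
  have hρ0 : 0 < ρ := (contractionBound_nonneg h0).trans_lt hρ
  -- The bound on `ρ` says `βR < ρ ^ γ̄`; by continuity an exponent slightly above `γ̄` still works.
  obtain ⟨g, hg, hgρ⟩ : ∃ g, asymptoticRiskAversion u < g ∧ β * R ≤ ρ ^ g := by
    have hlt : β * R < ρ ^ asymptoticRiskAversion u := by
      unfold contractionBound at hρ
      split_ifs at hρ with h
      · simpa [h] using h1
      · have hpos := hu.asymptoticRiskAversion_nonneg.lt_of_ne' h
        have := Real.rpow_lt_rpow (by positivity) hρ hpos
        rwa [← Real.rpow_mul h0.le, one_div_mul_cancel h, Real.rpow_one] at this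
    have hc : ContinuousAt (fun g : ℝ => ρ ^ g) (asymptoticRiskAversion u) :=
      Real.continuousAt_const_rpow hρ0.ne'
    have hev : ∀ᶠ g in 𝓝[>] asymptoticRiskAversion u, β * R < ρ ^ g :=
      (hc.tendsto.eventually (lt_mem_nhds hlt)).filter_mono nhdsWithin_le_nhds
    obtain ⟨g, hg1, hg2⟩ := (hev.and self_mem_nhdsWithin).exists
    exact ⟨g, hg2, hg1.le⟩
  obtain ⟨x₁, hx₁⟩ := eventually_atTop.1 (hu.eventually_riskAversion_lt hb hg)
  set x₂ := max x₁ 1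
  have hx₂ : 0 < x₂ := lt_max_of_lt_right one_pos
  -- The logarithmic derivative of `u'(x) x^g` is `(g - γ(x)) / x > 0` for large `x`. Comparing the
  -- points `ρ x` and `x` gives `ρ^g u'(ρ x) ≤ u'(x)`.
  have hmono : MonotoneOn (fun x => marginal u x * x ^ g) (Set.Ici x₂) := by
    have hder : ∀ x, x₂ ≤ x → HasDerivAt (fun x => marginal u x * x ^ g)
        (deriv (marginal u) x * x ^ g + marginal u x * (g * x ^ (g - 1))) x := fun x hx => by
      have hx0 := hx₂.trans_le hx
      exact (hu.differentiableAt_marginal hx0).hasDerivAt.mul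
        (Real.hasDerivAt_rpow_const (Or.inl hx0.ne'))
    refine monotoneOn_of_deriv_nonneg (convex_Ici _)
      (fun x hx => (hder x hx).continuousAt.continuousWithinAt)
      (fun x hx => (hder x (interior_subset hx)).differentiableAt.differentiableWithinAt)
      (fun x hx => ?_)
    have hx' : x₂ ≤ x := interior_subset hx
    have hx0 := hx₂.trans_le hx'
    rw [(hder x hx').deriv]
    have hra := hx₁ x ((le_max_left _ _).trans hx')
    unfold riskAversion at hra
    rw [div_lt_iff₀ (hu.marginal_pos x hx0)] at hra
    have : x ^ g = x * x ^ (g - 1) := by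
      rw [Real.rpow_sub_one hx0.ne']; field_simp
    rw [this]
    have hp : 0 < x ^ (g - 1) := Real.rpow_pos_of_pos hx0 _
    nlinarith
  refine ⟨x₂ / ρ, by positivity, fun x hx => ?_⟩
  rw [div_le_iff₀ hρ0] at hx
  have hx0 : 0 < x := by
    by_contra! h
    nlinarith
  have h := hmono (a := ρ * x) (b := x) (by simpa [mul_comm] using hx)
    (by simp only [Set.mem_Ici]; nlinarith) (by nlinarith)
  simp only at h
  rw [Real.mul_rpow hρ0.le hx0.le, ← mul_assoc] at h
  have h' := le_of_mul_le_mul_right h (Real.rpow_pos_of_pos hx0 g)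
  have := hu.marginal_pos (ρ * x) (by positivity)
  nlinarith

end UtilityAssumption

/-! ### Plans financed by initial wealth alone -/

/-- The deterministic consumption sequence `e` can be financed by initial wealth `w` without any
income and without borrowing. -/
def Financeable (R : ℝ) (e : ℕ → ℝ) (w : ℝ) : Prop :=
  ∃ b : ℕ → ℝ, b 0 ≤ w ∧ ∀ n, e n ≤ b n ∧ b (n + 1) ≤ R * (b n - e n)

theorem Financeable.mono {R : ℝ} {e : ℕ → ℝ} {w w' : ℝ} (h : Financeable R e w) (hw : w ≤ w') :
    Financeable R e w' :=
  let ⟨b, hb, h⟩ := h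
  ⟨b, hb.trans hw, h⟩

/-- The balance `b n` is the period-`n` value of all consumption from `n` on. -/
theorem financeable_tsum {R : ℝ} (hR : 0 < R) {e : ℕ → ℝ} (he : ∀ n, 0 ≤ e n)
    (hs : Summable fun n => e n / R ^ n) : Financeable R e (∑' n, e n / R ^ n) := by
  have hstep : ∀ n, ∑' k, e (k + n) / R ^ (k + n) =
      e n / R ^ n + ∑' k, e (k + (n + 1)) / R ^ (k + (n + 1)) := fun n => by
    rw [((summable_nat_add_iff n).2 hs).tsum_eq_zero_add]
    simp only [zero_add]
    congr 2
    ext k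
    rw [show k + 1 + n = k + (n + 1) by ring]
  refine ⟨fun n => R ^ n * ∑' k, e (k + n) / R ^ (k + n), by simp, fun n => ⟨?_, ?_⟩⟩
  · simp only
    rw [hstep n, mul_add, mul_div_cancel₀ _ (by positivity)]
    have : 0 ≤ ∑' k, e (k + (n + 1)) / R ^ (k + (n + 1)) :=
      tsum_nonneg fun k => div_nonneg (he _) (by positivity)
    have := mul_nonneg (pow_pos hR n).le this
    linarith
  · simp only
    rw [hstep n, mul_add, mul_div_cancel₀ _ (by positivity), pow_succ]
    linarith

/-- With wealth `w` and no income one can start consuming at `x` and continue with consumption at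
which marginal utility grows at most at the rate `1 / (β R)`. -/
def HasFinancedPath (u : ℝ → EReal) (β R x w : ℝ) : Prop :=
  ∃ e : ℕ → ℝ, e 0 = x ∧ (∀ n, 0 < e n) ∧
    (∀ n, (β * R) ^ n * marginal u (e n) ≤ marginal u x) ∧ Financeable R e w

theorem HasFinancedPath.cons {u : ℝ → EReal} {β R x y w : ℝ} (hβ : 0 < β) (hR : 0 < R)
    (hx : 0 < x) (hxy : β * R * marginal u y ≤ marginal u x) (h : HasFinancedPath u β R y w) :
    HasFinancedPath u β R x (x + w / R) := by
  obtain ⟨e, rfl, hpos, hm, b, hb, hstep⟩ := h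
  refine ⟨fun n => Nat.casesOn n x e, rfl, ?_, ?_, fun n => Nat.casesOn n (x + w / R) b, le_rfl, ?_⟩
  · rintro (_ | n)
    · exact hx
    · exact hpos n
  · rintro (_ | n)
    · simp
    · refine le_trans ?_ hxy
      simp only [pow_succ']
      rw [mul_assoc]
      exact mul_le_mul_of_nonneg_left (hm n) (by positivity)
  · rintro (_ | n)
    · have : 0 ≤ w / R := div_nonneg ((hpos 0).le.trans ((hstep 0).1.trans hb)) hR.le
      refine ⟨?_, ?_⟩
      · change x ≤ x + w / R
        linarith
      · change b 0 ≤ R * (x + w / R - x)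
        rwa [add_sub_cancel_left, mul_div_cancel₀ _ hR.ne']
    · exact hstep n

section FinancedPaths

variable {u : ℝ → EReal} {β R : ℝ}

theorem finiteValueWithoutIncome_of_one_lt (hβ : 0 ≤ β) (hβ1 : β < 1) (hR : 1 < R) :
    FiniteValueWithoutIncome u β R := by
  refine ⟨fun _ => 1, fun _ => one_pos, ?_, ?_⟩
  · simpa using summable_geometric_of_lt_one (by positivity) (inv_lt_one_of_one_lt₀ hR)
  · exact (summable_geometric_of_lt_one hβ hβ1).mul_right _

/-- For `R = 1`, a late tail of the given sequence has sum below `w`. For `R > 1`, the annuity `w (R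
- 1) / R` keeps wealth constant at `w`. -/
theorem exists_financeable_finite_utility (hβ : 0 < β) (hβ1 : β < 1) (hR : 1 ≤ R)
    (hfin : R = 1 → FiniteValueWithoutIncome u β R) {w : ℝ} (hw : 0 < w) :
    ∃ d : ℕ → ℝ, (∀ t, 0 < d t) ∧ Financeable R d w ∧
      Summable fun t => β ^ t * realUtility u (d t) := by
  rcases hR.eq_or_lt with rfl | hR
  · obtain ⟨d, hd, hs, hu⟩ := hfin rfl
    have hs' : Summable d := by simpa using hs
    obtain ⟨N, hN⟩ := ((tendsto_sum_nat_add d).eventually (gt_mem_nhds hw)).exists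
    refine ⟨fun t => d (t + N), fun t => hd _, ?_, ?_⟩
    · have := financeable_tsum (R := 1) one_pos (e := fun t => d (t + N)) (fun t => (hd _).le)
        (by simpa using (summable_nat_add_iff N).2 hs')
      exact this.mono (by simpa using hN.le)
    · have := ((summable_nat_add_iff N).2 hu).mul_left ((β ^ N)⁻¹)
      refine this.congr fun t => ?_
      rw [pow_add]
      field_simp
  · refine ⟨fun _ => w * (R - 1) / R, fun _ => div_pos (mul_pos hw (by linarith)) (by linarith),
      ⟨fun _ => w, le_rfl, fun _ => ⟨?_, ?_⟩⟩, ?_⟩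
    · rw [div_le_iff₀ (by linarith)]
      nlinarith
    · field_simp
      linarith
    · exact (summable_geometric_of_lt_one hβ.le hβ1).mul_right _

/-- Paths that start from a bounded consumption level need a bounded amount of wealth. -/
theorem UtilityAssumption.exists_hasFinancedPath_of_le (hu : UtilityAssumption u) (hβ : 0 < β)
    (hR : 0 < R) (hβR : β * R < 1) (hβ1 : β < 1) (hfin : FiniteValueWithoutIncome u β R) {x₀ : ℝ}
    (hx₀ : 0 < x₀) :
    ∃ K : ℝ, 0 ≤ K ∧ ∀ x, 0 < x → x ≤ x₀ → HasFinancedPath u β R x K := by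
  obtain ⟨d, hd, hs, hud⟩ := hfin
  have hm₀ := hu.marginal_pos x₀ hx₀
  have hβR0 : 0 < β * R := mul_pos hβ hR
  -- The increment over `d n` is chosen so that, when `f n < x₀`, concavity yields `u'(f n) (f n - d
  -- n) ≤ u(x₀) - u(d n) = u'(x₀) r n`, which is the required bound on `u'(f n)`. Its present value
  -- is `∑ β^n r n`, finite because `d` has finite utility.
  set r : ℕ → ℝ := fun n => max (realUtility u x₀ - realUtility u (d n)) 0 / marginal u x₀ with hr
  have hr0 : ∀ n, 0 ≤ r n := fun n => div_nonneg (le_max_right _ _) hm₀.le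
  set f : ℕ → ℝ := fun n => d n + (β * R) ^ n * r n with hf
  have hf0 : ∀ n, 0 < f n := fun n =>
    add_pos_of_pos_of_nonneg (hd n) (mul_nonneg (by positivity) (hr0 n))
  have hmf : ∀ n, (β * R) ^ n * marginal u (f n) ≤ marginal u x₀ := fun n => by
    have hp : (β * R) ^ n ≤ 1 := pow_le_one₀ hβR0.le hβR.le
    have hp0 : 0 < (β * R) ^ n := by positivity
    rcases le_or_gt x₀ (f n) with h | h
    · have := hu.marginal_strictAntiOn.antitoneOn hx₀ (hf0 n) h
      have := hu.marginal_pos (f n) (hf0 n)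
      nlinarith
    · have hdx : d n < x₀ := lt_of_le_of_lt
        (le_add_of_nonneg_right (mul_nonneg hp0.le (hr0 n))) h
      have hudx := hu.strictMonoOn (hd n) hx₀ hdx
      have hfx := hu.strictMonoOn (hf0 n) hx₀ h
      have hrn : r n = (realUtility u x₀ - realUtility u (d n)) / marginal u x₀ := by
        simp only [hr]
        rw [max_eq_left (by linarith)]
      have hrpos : 0 < r n := by
        rw [hrn]
        exact div_pos (by linarith) hm₀
      have ht := hu.le_tangent (hf0 n) (hd n)
      have hfd : f n - d n = (β * R) ^ n * r n := by simp [hf]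
      have h1 : marginal u (f n) * ((β * R) ^ n * r n) ≤ marginal u x₀ * r n := by
        have : marginal u x₀ * r n = realUtility u x₀ - realUtility u (d n) := by
          rw [hrn]; field_simp
        rw [this, ← hfd]
        linarith
      refine le_of_mul_le_mul_right ?_ hrpos
      linarith
  have hfs : Summable fun n => f n / R ^ n := by
    have h1 : Summable fun n => β ^ n * r n := by
      have h2 : Summable fun n => (|β ^ n * realUtility u x₀| + |β ^ n * realUtility u (d n)|)
          / marginal u x₀ :=
        ((((summable_geometric_of_lt_one hβ.le hβ1).mul_right _).abs).add hud.abs).div_const _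
      refine Summable.of_nonneg_of_le (fun n => mul_nonneg (by positivity) (hr0 n)) (fun n => ?_) h2
      simp only [hr]
      rw [← mul_div_assoc]
      refine div_le_div_of_nonneg_right ?_ hm₀.le
      rw [abs_mul, abs_mul, abs_of_pos (pow_pos hβ n), ← mul_add]
      refine mul_le_mul_of_nonneg_left (max_le ?_ (by positivity)) (by positivity)
      linarith [le_abs_self (realUtility u x₀), neg_abs_le (realUtility u (d n))]
    refine (hs.add h1).congr fun n => ?_
    simp only [hf]
    rw [mul_pow]
    field_simp
  have hfin' := financeable_tsum hR (fun n => (hf0 n).le) hfs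
  set s := ∑' n, f n / R ^ n
  obtain ⟨b, hb, hstep⟩ := hfin'
  -- Only the first term of `f` is replaced by `x`. The extra `x₀` pays for it and leaves at least
  -- `s` for the rest.
  refine ⟨x₀ + s, add_nonneg hx₀.le (tsum_nonneg fun n => div_nonneg (hf0 n).le (by positivity)),
    fun x hx hxx => ⟨fun n => Nat.casesOn n x fun k => f (k + 1), rfl, ?_, ?_,
      fun n => Nat.casesOn n (x₀ + s) fun k => b (k + 1), le_rfl, ?_⟩⟩
  · rintro (_ | n)
    · exact hx
    · exact hf0 _
  · rintro (_ | n)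
    · simp
    · exact (hmf (n + 1)).trans (hu.marginal_strictAntiOn.antitoneOn hx hx₀ hxx)
  · have hs0 : 0 ≤ s := tsum_nonneg fun n => div_nonneg (hf0 n).le (by positivity)
    rintro (_ | n)
    · refine ⟨?_, ?_⟩
      · change x ≤ x₀ + s
        linarith
      · refine (hstep 0).2.trans (mul_le_mul_of_nonneg_left ?_ hR.le)
        change b 0 - f 0 ≤ x₀ + s - x
        have := hf0 0
        linarith
    · exact hstep (n + 1)

/-- The wealth needed to finance a path that starts from a large consumption level. -/
theorem UtilityAssumption.exists_hasFinancedPath (hu : UtilityAssumption u)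
    (hb : BoundedRiskAversion u) (hβ : 0 < β) (hR : 1 ≤ R) (hβR : β * R < 1)
    (hfin : FiniteValueWithoutIncome u β R) {ρ : ℝ} (hρ : contractionBound u β R < ρ)
    (hρ1 : ρ < 1) :
    ∃ K : ℝ, 0 ≤ K ∧ ∀ x, 0 < x → HasFinancedPath u β R x (K + x / (1 - ρ / R)) := by
  have hR0 : 0 < R := by linarith
  have hβR0 : 0 < β * R := by positivity
  have hβ1 : β < 1 := by nlinarith
  have hρ0 : 0 < ρ := (contractionBound_nonneg hβR0).trans_lt hρ
  obtain ⟨x₀, hx₀, hmx⟩ := hu.exists_marginal_mul_le hb hβR0 hβR hρ hρ1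
  obtain ⟨K, hK, hbase⟩ := hu.exists_hasFinancedPath_of_le hβ hR0 hβR hβ1 hfin hx₀
  have hκ : 0 < 1 - ρ / R := by
    rw [sub_pos, div_lt_one hR0]
    linarith
  have hmono : ∀ {x w w'}, w ≤ w' → HasFinancedPath u β R x w → HasFinancedPath u β R x w' :=
    fun hw ⟨e, h1, h2, h3, h4⟩ => ⟨e, h1, h2, h3, h4.mono hw⟩
  refine ⟨K, hK, ?_⟩
  -- Induction on the number of shrinkings by `ρ` that bring `x` below `x₀`.
  have key : ∀ n : ℕ, ∀ x, 0 < x → ρ ^ n * x ≤ x₀ →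
      HasFinancedPath u β R x (K + x / (1 - ρ / R)) := by
    intro n
    induction n with
    | zero =>
      intro x hx hxx
      exact hmono (by have := div_pos hx hκ; linarith) (hbase x hx (by simpa using hxx))
    | succ n ih =>
      intro x hx hxx
      rcases le_or_gt x x₀ with h | h
      · exact hmono (by have := div_pos hx hκ; linarith) (hbase x hx h)
      · have := (ih (ρ * x) (by positivity) (by rwa [← mul_assoc, ← pow_succ])).cons hβ hR0 hx
          (hmx x h.le)
        refine hmono ?_ this
        have h1 : K / R ≤ K := div_le_self hK hR
        -- The slope `1 / (1 - ρ / R)` is the fixed point of prepending a period; the constant `K`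
        -- does not grow because `R ≥ 1`.
        have h2 : x + ρ * x / (1 - ρ / R) / R = x / (1 - ρ / R) := by
          have : R - ρ ≠ 0 := by linarith
          have h3 : 1 - ρ / R = (R - ρ) / R := by field_simp
          rw [h3]
          field_simp
          ring
        rw [add_div]
        linarith
  intro x hx
  obtain ⟨n, hn⟩ := exists_pow_lt_of_lt_one (div_pos hx₀ hx) hρ1
  exact key n x hx ((lt_div_iff₀ hx).1 hn).le

end FinancedPaths

/-! ### Raising consumption temporarily and repaying the debt later -/

section Deviation

variable {Ω Z : Type*}

open Classical in
/-- The reduction of consumption in period `s` for an agent who, on the event `E`, consumes `e 0`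
in period `t` and afterwards repays the accumulated debt `D` whenever the original consumption in
period `t + n` exceeds `e n`. -/
noncomputable def repayment (E : Set Ω) (t : ℕ) (e : ℕ → ℝ) (c : ℕ → Ω → ℝ) (s : ℕ) (D : ℝ)
    (ω : Ω) : ℝ :=
  if s < t then 0 else if s = t then (if ω ∈ E then c t ω - e 0 else 0)
  else min D (max (c s ω - e (s - t)) 0)

/-- The debt accumulated before period `s`, see `repayment`. -/
noncomputable def debt (R : ℝ) (E : Set Ω) (t : ℕ) (e : ℕ → ℝ) (c : ℕ → Ω → ℝ) : ℕ → Ω → ℝ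
  | 0, _ => 0
  | s + 1, ω => R * (debt R E t e c s ω - repayment E t e c s (debt R E t e c s ω) ω)

/-- The consumption plan with temporarily raised consumption, see `repayment`. -/
noncomputable def deviation (R : ℝ) (E : Set Ω) (t : ℕ) (e : ℕ → ℝ) (c : ℕ → Ω → ℝ) (s : ℕ)
    (ω : Ω) : ℝ :=
  c s ω - repayment E t e c s (debt R E t e c s ω) ω

variable {R a₀ : ℝ} {y : Z → ℝ} {z : ℕ → Ω → Z} {E : Set Ω} {t : ℕ} {e : ℕ → ℝ}
  {c : ℕ → Ω → ℝ} {ω : Ω}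

theorem wealth_deviation (s : ℕ) : wealth R a₀ y z (deviation R E t e c) s ω =
    wealth R a₀ y z c s ω - debt R E t e c s ω := by
  induction s with
  | zero => simp [wealth, debt]
  | succ s ih =>
    simp only [wealth, debt, ih, deviation]
    ring

theorem debt_of_le {s : ℕ} (hs : s ≤ t) : debt R E t e c s ω = 0 := by
  induction s with
  | zero => rfl
  | succ s ih =>
    simp [debt, ih (by omega), repayment, show s < t by omega]

theorem deviation_of_lt {s : ℕ} (hs : s < t) : deviation R E t e c s ω = c s ω := by
  simp [deviation, repayment, hs]

theorem deviation_self (hω : ω ∈ E) : deviation R E t e c t ω = e 0 := by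
  simp [deviation, repayment, hω]

theorem debt_of_notMem (hω : ω ∉ E) (s : ℕ) : debt R E t e c s ω = 0 := by
  induction s with
  | zero => rfl
  | succ s ih => simp [debt, ih, repayment, hω]

theorem deviation_of_notMem (hω : ω ∉ E) (s : ℕ) : deviation R E t e c s ω = c s ω := by
  simp [deviation, debt_of_notMem hω, repayment, hω]

theorem repayment_of_lt {s : ℕ} (hs : t < s) (D : ℝ) :
    repayment E t e c s D ω = min D (max (c s ω - e (s - t)) 0) := by
  simp [repayment, hs.ne', hs.not_gt]

theorem debt_succ_self (hω : ω ∈ E) : debt R E t e c (t + 1) ω = R * (e 0 - c t ω) := by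
  simp [debt, debt_of_le le_rfl, repayment, hω]

theorem debt_nonneg (hR : 0 ≤ R) (hω : ω ∈ E) (hc : c t ω ≤ e 0) (s : ℕ) :
    0 ≤ debt R E t e c s ω := by
  induction s with
  | zero => exact le_rfl
  | succ s ih =>
    rcases lt_trichotomy s t with h | rfl | h
    · exact (debt_of_le (by omega)).ge
    · rw [debt_succ_self hω]
      exact mul_nonneg hR (by linarith)
    · rw [debt, repayment_of_lt h]
      exact mul_nonneg hR (sub_nonneg.2 (min_le_left _ _))

theorem deviation_feasible (hR : 0 ≤ R) (hy : ∀ s, 0 ≤ y s)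
    (hc : ∀ s, 0 ≤ c s ω ∧ c s ω ≤ wealth R a₀ y z c s ω) (he : ∀ n, 0 ≤ e n)
    (hω : ω ∈ E) (hce : c t ω ≤ e 0) (hfin : Financeable R e (wealth R a₀ y z c t ω)) (s : ℕ) :
    0 ≤ deviation R E t e c s ω ∧
      deviation R E t e c s ω ≤ wealth R a₀ y z (deviation R E t e c) s ω := by
  obtain ⟨b, hb, hstep⟩ := hfin
  rcases lt_trichotomy s t with h | rfl | h
  · rw [wealth_deviation, deviation_of_lt h, debt_of_le h.le, sub_zero]
    exact hc s
  · rw [wealth_deviation, deviation_self hω, debt_of_le le_rfl, sub_zero]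
    exact ⟨he 0, (hstep 0).1.trans hb⟩
  · have hD := debt_nonneg (R := R) hR hω hce
    -- Either the debt is already repaid, or repayment so far has been partial. In the latter case
    -- consumption has stayed at or below `e`, so wealth dominates the balances `b` that finance
    -- `e`; income only helps.
    have key : ∀ n, debt R E t e c (t + 1 + n) ω = 0 ∨
        b (n + 1) ≤ wealth R a₀ y z (deviation R E t e c) (t + 1 + n) ω := by
      intro n
      induction n with
      | zero =>
        right
        rw [add_zero, wealth, deviation_self hω, wealth_deviation, debt_of_le le_rfl, sub_zero]
        have := mul_le_mul_of_nonneg_left (sub_le_sub_right hb (e 0)) hR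
        linarith [(hstep 0).2, hy (z (t + 1) ω)]
      | succ n ih =>
        have ht : t < t + 1 + n := by omega
        have hrep := repayment_of_lt (E := E) (e := e) (c := c) (ω := ω) ht
          (debt R E t e c (t + 1 + n) ω)
        rw [show t + 1 + n - t = n + 1 by omega] at hrep
        rw [show t + 1 + (n + 1) = (t + 1 + n) + 1 by omega]
        rcases ih with ih | ih
        · left
          rw [debt, hrep, ih]
          simp
        · rcases le_total (debt R E t e c (t + 1 + n) ω)
            (max (c (t + 1 + n) ω - e (n + 1)) 0) with h1 | h1
          · left
            rw [debt, hrep, min_eq_left h1, sub_self, mul_zero]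
          · right
            have hdev : deviation R E t e c (t + 1 + n) ω ≤ e (n + 1) := by
              rw [deviation, hrep, min_eq_right h1]
              linarith [le_max_left (c (t + 1 + n) ω - e (n + 1)) 0]
            rw [wealth]
            have := mul_le_mul_of_nonneg_left (sub_le_sub ih hdev) hR
            linarith [(hstep (n + 1)).2, hy (z (t + 1 + n + 1) ω)]
    obtain ⟨n, rfl⟩ : ∃ n, s = t + 1 + n := ⟨s - t - 1, by omega⟩
    have hrep := repayment_of_lt (E := E) (e := e) (c := c) (ω := ω) h
      (debt R E t e c (t + 1 + n) ω)
    rw [show t + 1 + n - t = n + 1 by omega] at hrep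
    refine ⟨?_, ?_⟩
    · rw [deviation, hrep]
      refine sub_nonneg.2 ((min_le_right _ _).trans (max_le ?_ (hc _).1))
      linarith [he (n + 1)]
    · rcases le_total (debt R E t e c (t + 1 + n) ω)
        (max (c (t + 1 + n) ω - e (n + 1)) 0) with h1 | h1
      · rw [wealth_deviation, deviation, hrep, min_eq_left h1]
        linarith [(hc (t + 1 + n)).2]
      · have hdev : deviation R E t e c (t + 1 + n) ω ≤ e (n + 1) := by
          rw [deviation, hrep, min_eq_right h1]
          linarith [le_max_left (c (t + 1 + n) ω - e (n + 1)) 0]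
        rcases key n with h2 | h2
        · rw [wealth_deviation, deviation, hrep, h2, min_eq_left (le_max_right _ _)]
          linarith [(hc (t + 1 + n)).2]
        · exact hdev.trans ((hstep _).1.trans h2)

/-- Discounted debt falls by exactly the discounted repayment each period, so the sum telescopes,
and the remaining debt is nonnegative. -/
theorem sum_repayment_le (hR : 0 < R) (hω : ω ∈ E) (hce : c t ω ≤ e 0) (T : ℕ) :
    ∑ s ∈ Finset.range T, (if s ≤ t then 0 else
      repayment E t e c s (debt R E t e c s ω) ω / R ^ (s - t)) ≤ e 0 - c t ω := by
  have key : ∀ T, ∑ s ∈ Finset.range T, (if s ≤ t then 0 else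
      repayment E t e c s (debt R E t e c s ω) ω / R ^ (s - t)) +
      (if T ≤ t then e 0 - c t ω else debt R E t e c T ω / R ^ (T - t)) = e 0 - c t ω := by
    intro T
    induction T with
    | zero => simp
    | succ T ih =>
      rw [Finset.sum_range_succ]
      rcases lt_trichotomy T t with h | rfl | h
      · rw [if_pos h.le] at ih ⊢
        rw [if_pos (by omega), add_zero]
        exact ih
      · rw [if_pos le_rfl] at ih ⊢
        rw [if_neg (by omega), debt_succ_self hω, show T + 1 - T = 1 by omega, pow_one,
          mul_div_cancel_left₀ _ hR.ne', add_zero]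
        exact ih
      · rw [if_neg (by omega)] at ih ⊢
        rw [if_neg (by omega), debt, show T + 1 - t = (T - t) + 1 by omega, pow_succ']
        rw [mul_div_mul_left _ _ hR.ne']
        rw [← ih]
        ring
  have h := key T
  have : 0 ≤ (if T ≤ t then e 0 - c t ω else debt R E t e c T ω / R ^ (T - t)) := by
    split_ifs
    · linarith
    · exact div_nonneg (debt_nonneg hR.le hω hce T) (by positivity)
  linarith

variable {mΩ : MeasurableSpace Ω} {ℱ : Filtration ℕ mΩ}

theorem measurable_deviation (hc : Adapted ℱ c) (hE : MeasurableSet[ℱ t] E) (s : ℕ) :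
    Measurable[ℱ s] (deviation R E t e c s) := by
  have hrep : ∀ s, Measurable[ℱ s] (debt R E t e c s) →
      Measurable[ℱ s] fun ω => repayment E t e c s (debt R E t e c s ω) ω := by
    intro s hD
    rcases lt_trichotomy s t with h | rfl | h
    · simp only [repayment, if_pos h]
      exact measurable_const
    · simp only [repayment, lt_irrefl, if_false, if_true]
      exact Measurable.ite hE ((hc s).sub measurable_const) measurable_const
    · simp only [repayment_of_lt h]
      exact hD.min (((hc s).sub measurable_const).max measurable_const)
  have hdebt : ∀ s, Measurable[ℱ s] (debt R E t e c s) := by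
    intro s
    induction s with
    | zero => exact measurable_const
    | succ s ih =>
      exact ((ih.sub (hrep s ih)).const_mul R).mono (ℱ.mono s.le_succ) le_rfl
  exact (hc s).sub (hrep s (hdebt s))

end Deviation

/-! ### Comparison of utilities along a path -/

/-- The inequality `X ≤ Y + k` is rearranged so that only sums of positive and negative parts occur;
no subtraction of possibly infinite quantities is needed. -/
theorem toENNReal_add_le_of_le {X : EReal} {Y k : ℝ} (h : X ≤ ((Y + k : ℝ) : EReal)) :
    X.toENNReal + (-(Y : EReal)).toENNReal + ENNReal.ofReal (-k) ≤
      (Y : EReal).toENNReal + (-X).toENNReal + ENNReal.ofReal k := by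
  induction X with
  | bot => simp
  | top => exact absurd (top_le_iff.1 h) (EReal.coe_ne_top _)
  | coe x =>
    rw [EReal.coe_le_coe_iff] at h
    rw [← EReal.coe_neg, ← EReal.coe_neg]
    simp only [EReal.real_coe_toENNReal]
    simp only [ENNReal.ofReal]
    norm_cast
    rw [← NNReal.coe_le_coe]
    simp only [NNReal.coe_add, Real.coe_toNNReal']
    rcases max_cases x 0 with h1 | h1 <;> rcases max_cases (-Y) 0 with h2 | h2 <;>
    rcases max_cases (-k) 0 with h3 | h3 <;> rcases max_cases Y 0 with h4 | h4 <;>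
    rcases max_cases (-x) 0 with h5 | h5 <;> rcases max_cases k 0 with h6 | h6 <;> linarith

/-- A gain `G` in period `t` outweighs losses `l s` elsewhere. Finiteness of the total loss `L`
allows it to be cancelled. -/
theorem tsum_add_le_of_gain {p n p' n' l : ℕ → ℝ≥0∞} {t : ℕ} {G L g : ℝ≥0∞}
    (h : ∀ s, s ≠ t → p s + n' s ≤ p' s + n s + l s) (ht : p t + n' t + G ≤ p' t + n t)
    (hl : ∑' s, l s ≤ L) (hL : L ≠ ⊤) (hg : g + L ≤ G) :
    ∑' s, p s + ∑' s, n' s + g ≤ ∑' s, p' s + ∑' s, n s := by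
  have h1 : ∑' s, (p s + n' s + (if s = t then G else 0)) ≤ ∑' s, (p' s + n s + l s) := by
    refine ENNReal.tsum_le_tsum fun s => ?_
    by_cases hs : s = t
    · subst hs
      rw [if_pos rfl]
      exact ht.trans le_self_add
    · rw [if_neg hs, add_zero]
      exact h s hs
  simp only [ENNReal.tsum_add, tsum_ite_eq] at h1
  refine (ENNReal.add_le_add_iff_right hL).1 ?_
  calc _ = ∑' s, p s + ∑' s, n' s + (g + L) := by ring
    _ ≤ ∑' s, p s + ∑' s, n' s + G := by gcongr
    _ ≤ _ := h1
    _ ≤ _ := by gcongr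

/-- Lifetime utility, positive part, along a consumption path. -/
noncomputable def posUtility (u : ℝ → EReal) (β : ℝ) (c : ℕ → ℝ) : ℝ≥0∞ :=
  ∑' s, ENNReal.ofReal (β ^ s) * (u (c s)).toENNReal

/-- Lifetime utility, negative part, along a consumption path. -/
noncomputable def negUtility (u : ℝ → EReal) (β : ℝ) (c : ℕ → ℝ) : ℝ≥0∞ :=
  ∑' s, ENNReal.ofReal (β ^ s) * (-(u (c s))).toENNReal

/-- The deviation raises lifetime utility along each path in `E`. -/
theorem UtilityAssumption.utility_deviation {Ω : Type*} {u : ℝ → EReal} (hu : UtilityAssumption u)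
    {β R : ℝ} (hβ : 0 < β) (hR : 0 < R) {E : Set Ω} {t : ℕ} {e : ℕ → ℝ} {c : ℕ → Ω → ℝ} {ω : Ω}
    {x : ℝ} (hc : ∀ s, 0 ≤ c s ω) (he : ∀ n, 0 < e n)
    (hm : ∀ n, (β * R) ^ n * marginal u (e n) ≤ marginal u (e 0)) (hω : ω ∈ E)
    (hcx : c t ω ≤ x) (hx0 : 0 < x) (hx : x ≤ e 0) :
    posUtility u β (fun s => c s ω) + negUtility u β (fun s => deviation R E t e c s ω) +
      ENNReal.ofReal (β ^ t * (realUtility u (e 0) + marginal u (e 0) * (x - e 0) -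
        realUtility u x)) ≤
    posUtility u β (fun s => deviation R E t e c s ω) + negUtility u β (fun s => c s ω) := by
  have hce : c t ω ≤ e 0 := hcx.trans hx
  have hβt : ∀ s, 0 < β ^ s := fun s => pow_pos hβ s
  have hm0 := hu.marginal_pos _ (he 0)
  set r : ℕ → ℝ := fun s => repayment E t e c s (debt R E t e c s ω) ω with hr
  have hr0 : ∀ s, t < s → 0 ≤ r s := fun s hs => by
    simp only [hr, repayment_of_lt hs]
    exact le_min (debt_nonneg hR.le hω hce s) (le_max_right _ _)
  have hg0 : 0 ≤ realUtility u (e 0) + marginal u (e 0) * (x - e 0) - realUtility u x := by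
    linarith [hu.le_tangent (he 0) hx0]
  -- The gain `G` splits into the tangent gap at `x`, which is the net gain, and the value at
  -- marginal utility `u'(e 0)` of the borrowed amount, which covers the loss `L` from repayments.
  refine tsum_add_le_of_gain (t := t)
    (l := fun s => ENNReal.ofReal (β ^ t * marginal u (e 0) *
      (if s ≤ t then 0 else r s / R ^ (s - t))))
    (L := ENNReal.ofReal (β ^ t * marginal u (e 0) * (e 0 - c t ω)))
    (G := ENNReal.ofReal (β ^ t) * ENNReal.ofReal
      (realUtility u (e 0) + marginal u (e 0) * (x - e 0) - realUtility u x +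
        marginal u (e 0) * (e 0 - c t ω))) ?_ ?_ ?_ ENNReal.ofReal_ne_top ?_
  · intro s hs
    beta_reduce
    rcases lt_or_gt_of_ne hs with h | h
    · rw [deviation_of_lt h]
      exact le_self_add
    · rcases (hr0 s h).eq_or_lt with h0 | h0
      · have : deviation R E t e c s ω = c s ω := by
          simp only [deviation]
          change c s ω - r s = _
          rw [← h0, sub_zero]
        rw [this]
        exact le_self_add
      · rw [if_neg (by omega)]
        have hdev : deviation R E t e c s ω = c s ω - r s := rfl
        -- A positive repayment leaves consumption at or above `e (s - t)`, so each repaid unit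
        -- costs at most `u'(e (s - t))`.
        have hrle : r s ≤ c s ω - e (s - t) := by
          have h1 : r s ≤ max (c s ω - e (s - t)) 0 := by
            simp only [hr, repayment_of_lt h]
            exact min_le_right _ _
          rcases le_max_iff.1 h1 with h2 | h2
          · exact h2
          · exact absurd h2 h0.not_ge
        have hepos := he (s - t)
        have hdpos : 0 < deviation R E t e c s ω := by rw [hdev]; linarith
        have hmle : marginal u (deviation R E t e c s ω) ≤ marginal u (e (s - t)) :=
          hu.marginal_strictAntiOn.antitoneOn hepos hdpos (by rw [hdev]; linarith)
        have htan := hu.le_coe_tangent hdpos (hc s)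
        rw [show c s ω - deviation R E t e c s ω = r s by rw [hdev]; ring] at htan
        have h1 := toENNReal_add_le_of_le htan
        rw [hu.coe_realUtility hdpos] at h1
        have h2 := mul_le_mul_right (le_self_add.trans h1) (ENNReal.ofReal (β ^ s))
        rw [mul_add, mul_add, mul_add, ← ENNReal.ofReal_mul (hβt s).le] at h2
        refine h2.trans (add_le_add le_rfl (ENNReal.ofReal_le_ofReal ?_))
        have h3 : β ^ s * R ^ (s - t) = β ^ t * (β * R) ^ (s - t) := by
          rw [mul_pow, ← mul_assoc, ← pow_add, show t + (s - t) = s by omega]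
        have hRp : 0 < R ^ (s - t) := by positivity
        have h4 : β ^ s * marginal u (e (s - t)) ≤ β ^ t * marginal u (e 0) / R ^ (s - t) := by
          rw [le_div_iff₀ hRp]
          calc _ = β ^ s * R ^ (s - t) * marginal u (e (s - t)) := by ring
            _ = β ^ t * ((β * R) ^ (s - t) * marginal u (e (s - t))) := by rw [h3]; ring
            _ ≤ _ := mul_le_mul_of_nonneg_left (hm _) (hβt t).le
        calc _ ≤ β ^ s * (marginal u (e (s - t)) * r s) := by gcongr
          _ = β ^ s * marginal u (e (s - t)) * r s := by ring
          _ ≤ β ^ t * marginal u (e 0) / R ^ (s - t) * r s := by gcongr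
          _ = _ := by ring
  · simp only [deviation_self hω]
    have htan := hu.le_coe_tangent hx0 (hc t)
    have hmx : marginal u (e 0) ≤ marginal u x :=
      hu.marginal_strictAntiOn.antitoneOn hx0 (he 0) hx
    have h0 : u (c t ω) ≤ ((realUtility u (e 0) + -(realUtility u (e 0) +
        marginal u (e 0) * (x - e 0) - realUtility u x +
        marginal u (e 0) * (e 0 - c t ω)) : ℝ) : EReal) := by
      refine htan.trans (EReal.coe_le_coe_iff.2 ?_)
      nlinarith
    have h1 := toENNReal_add_le_of_le h0
    rw [hu.coe_realUtility (he 0), neg_neg, ENNReal.ofReal_of_nonpos (p := -_), add_zero] at h1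
    · have h2 := mul_le_mul_right h1 (ENNReal.ofReal (β ^ t))
      rwa [mul_add, mul_add, mul_add] at h2
    · have := mul_nonneg hm0.le (sub_nonneg.2 hce)
      linarith
  · rw [ENNReal.tsum_eq_iSup_nat]
    refine iSup_le fun T => ?_
    rw [← ENNReal.ofReal_sum_of_nonneg]
    · refine ENNReal.ofReal_le_ofReal ?_
      rw [← Finset.mul_sum]
      exact mul_le_mul_of_nonneg_left (sum_repayment_le hR hω hce T) (by positivity)
    · intro s _
      refine mul_nonneg (by positivity) ?_
      split_ifs with h
      · exact le_rfl
      · exact div_nonneg (hr0 s (by omega)) (by positivity)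
  · have := mul_nonneg hm0.le (sub_nonneg.2 hce)
    rw [← ENNReal.ofReal_mul (hβt t).le, ← ENNReal.ofReal_add (by positivity) (by
      rw [mul_assoc]; exact mul_nonneg (hβt t).le this)]
    refine ENNReal.ofReal_le_ofReal ?_
    linarith

/-! ### Expected utility -/

section ExpectedUtility

variable {Ω Z : Type*} {mΩ : MeasurableSpace Ω} {P : Measure Ω} {ℱ : Filtration ℕ mΩ}
  {z : ℕ → Ω → Z} {y : Z → ℝ} {u : ℝ → EReal} {β R a₀ : ℝ} {c : ℕ → Ω → ℝ}

theorem UtilityAssumption.aemeasurable_comp (hu : UtilityAssumption u) {X : Ω → ℝ}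
    (hX : Measurable X) (h0 : ∀ᵐ ω ∂P, 0 ≤ X ω) : AEMeasurable (fun ω => u (X ω)) P := by
  refine ⟨fun ω => u (max (X ω) 0), hu.monotone_max.measurable.comp hX, ?_⟩
  filter_upwards [h0] with ω hω
  rw [max_eq_left hω]

theorem UtilityAssumption.aemeasurable_negUtility (hu : UtilityAssumption u)
    (hc : ∀ t, Measurable (c t)) (h0 : ∀ t, ∀ᵐ ω ∂P, 0 ≤ c t ω) :
    AEMeasurable (fun ω => negUtility u β fun s => c s ω) P :=
  AEMeasurable.tsum fun s =>
    (measurable_ereal_toENNReal.comp_aemeasurable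
      (hu.aemeasurable_comp (hc s) (h0 s)).neg).const_mul _

theorem IsFeasible.measurable (hc : IsFeasible P ℱ R a₀ y z c) (t : ℕ) : Measurable (c t) :=
  (hc.1 t).mono (ℱ.le t) le_rfl

theorem UtilityAssumption.toENNReal_le (hu : UtilityAssumption u) {x w : ℝ} (hx : 0 ≤ x)
    (hxw : x ≤ w) : (u x).toENNReal ≤
      ENNReal.ofReal |realUtility u 1| + ENNReal.ofReal (marginal u 1) * ENNReal.ofReal w := by
  have hm := hu.marginal_pos 1 one_pos
  rw [← ENNReal.ofReal_mul hm.le, ← ENNReal.ofReal_add (abs_nonneg _)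
    (mul_nonneg hm.le (hx.trans hxw)), ← EReal.real_coe_toENNReal]
  refine EReal.toENNReal_le_toENNReal ((hu.le_coe_tangent one_pos hx).trans ?_)
  refine EReal.coe_le_coe_iff.2 ?_
  nlinarith [le_abs_self (realUtility u 1)]

theorem lifetimeUtility_eq : lifetimeUtility P u β c =
    ((∫⁻ ω, posUtility u β (fun s => c s ω) ∂P : ℝ≥0∞) : EReal) -
      ((∫⁻ ω, negUtility u β (fun s => c s ω) ∂P : ℝ≥0∞) : EReal) := rfl

/-- Consuming a financeable deterministic sequence is feasible. -/
theorem isFeasible_of_financeable (hR : 0 ≤ R) (hy : ∀ s, 0 ≤ y s) {d : ℕ → ℝ}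
    (hd : ∀ n, 0 ≤ d n) (hfin : Financeable R d a₀) :
    IsFeasible P ℱ R a₀ y z fun t _ => d t := by
  obtain ⟨b, hb, hstep⟩ := hfin
  have key : ∀ t ω, b t ≤ wealth R a₀ y z (fun t _ => d t) t ω := by
    intro t ω
    induction t with
    | zero => exact hb
    | succ t ih =>
      rw [wealth]
      have := mul_le_mul_of_nonneg_left (sub_le_sub_right ih (d t)) hR
      linarith [(hstep t).2, hy (z (t + 1) ω)]
  exact ⟨fun t => measurable_const, fun t => Eventually.of_forall fun ω =>
    ⟨hd t, (hstep t).1.trans (key t ω)⟩⟩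

theorem contractionProperty_of_lt_one (hR : 0 ≤ R) :
    ContractionProperty P ℱ u β R y z R := by
  refine ⟨0, le_rfl, fun a₀ c _ hc => ?_⟩
  filter_upwards [ae_all_iff.2 hc.1.2] with ω hω t _
  rw [wealth]
  have := mul_nonneg hR (hω t).1
  linarith

/-- An infinite negative part would give the solution utility `-∞`, while a deterministic plan
financed by `a₀` does better. -/
theorem IsSolution.lintegral_negUtility_lt_top [IsProbabilityMeasure P] (hu : UtilityAssumption u)
    (hβ : 0 < β) (hR : 1 ≤ R) (hβR : β * R < 1) (hy : ∀ s, 0 ≤ y s)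
    (hfin : R = 1 → FiniteValueWithoutIncome u β R) (ha₀ : 0 < a₀)
    (hc : IsSolution P ℱ u β R a₀ y z c) :
    ∫⁻ ω, negUtility u β (fun s => c s ω) ∂P < ⊤ := by
  obtain ⟨d, hd, hdf, hs⟩ := exists_financeable_finite_utility hβ (by nlinarith) hR hfin ha₀
  have h := hc.2 _ (isFeasible_of_financeable (by linarith) hy (fun n => (hd n).le) hdf)
  have hneg : negUtility u β d ≠ ⊤ := by
    unfold negUtility
    have : ∀ s, ENNReal.ofReal (β ^ s) * (-(u (d s))).toENNReal =
        ENNReal.ofReal (-(β ^ s * realUtility u (d s))) := fun s => by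
      rw [← hu.coe_realUtility (hd s), ← EReal.coe_neg, EReal.real_coe_toENNReal,
        ← ENNReal.ofReal_mul (by positivity), mul_neg]
    simp only [this]
    exact hs.neg.tsum_ofReal_ne_top
  by_contra! htop
  rw [top_le_iff] at htop
  rw [lifetimeUtility_eq, lifetimeUtility_eq, htop, EReal.coe_ennreal_top, EReal.sub_top,
    le_bot_iff] at h
  simp only [lintegral_const, measure_univ, mul_one] at h
  rw [sub_eq_add_neg, EReal.add_eq_bot_iff, EReal.neg_eq_bot_iff] at h
  rcases h with h | h
  · exact EReal.coe_ennreal_ne_bot _ h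
  · exact hneg (EReal.coe_ennreal_eq_top_iff.1 h)

/-! ### Markov income, finiteness of expected utility and optimality -/

variable [MeasurableSpace Z] {κ : ℕ → Kernel Z Z}

theorem IsMarkovProcess.measurable (hz : IsMarkovProcess P ℱ κ z) (t : ℕ) : Measurable (z t) :=
  (hz.1 t).mono (ℱ.le t) le_rfl

theorem IsMarkovProcess.map_succ [IsProbabilityMeasure P] [∀ t, IsMarkovKernel (κ t)] (hz : IsMarkovProcess P ℱ κ z)
    (t : ℕ) : P.map (z (t + 1)) = (P.map (z t)).bind (κ t) := by
  ext B hB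
  have hB' := hz.measurable (t + 1) hB
  have hm : Measurable fun ω => κ t (z t ω) B :=
    ((κ t).measurable_coe hB).comp (hz.measurable t)
  rw [Measure.map_apply (hz.measurable _) hB, Measure.bind_apply hB (κ t).measurable.aemeasurable,
    lintegral_map ((κ t).measurable_coe hB) (hz.measurable t)]
  have h1 : ∫ ω, (κ t (z t ω) B).toReal ∂P = P.real (z (t + 1) ⁻¹' B) := by
    change ∫ ω, (κ t (z t ω)).real B ∂P = _
    rw [← integral_congr_ae (hz.2 t B hB), integral_condExp (ℱ.le t),
      integral_indicator_const _ hB', smul_eq_mul, mul_one]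
  rw [← ENNReal.ofReal_toReal (measure_ne_top P (z (t + 1) ⁻¹' B))]
  change ENNReal.ofReal (P.real _) = _
  rw [← h1, integral_toReal hm.aemeasurable (Eventually.of_forall fun ω => measure_lt_top _ _)]
  refine ENNReal.ofReal_toReal (ne_of_lt ?_)
  calc ∫⁻ ω, κ t (z t ω) B ∂P ≤ ∫⁻ _, 1 ∂P := lintegral_mono fun ω => prob_le_one
    _ < ⊤ := by simp

theorem lintegral_income_le [IsProbabilityMeasure P] [∀ t, IsMarkovKernel (κ t)] (hz : IsMarkovProcess P ℱ κ z)
    (hy : Measurable y) (t : ℕ) : ∫⁻ ω, ENNReal.ofReal (y (z (t + 1) ω)) ∂P ≤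
      ⨆ (t : ℕ) (s : Z), ∫⁻ s', ENNReal.ofReal (y s') ∂(κ t s) := by
  rw [← lintegral_map (f := fun s => ENNReal.ofReal (y s)) hy.ennreal_ofReal
    (hz.measurable (t + 1)), hz.map_succ t,
    Measure.lintegral_bind (κ t).measurable.aemeasurable hy.ennreal_ofReal.aemeasurable,
    lintegral_map hy.ennreal_ofReal.lintegral_kernel (hz.measurable t)]
  calc _ ≤ ∫⁻ _, (⨆ (t : ℕ) (s : Z), ∫⁻ s', ENNReal.ofReal (y s') ∂(κ t s)) ∂P :=
        lintegral_mono fun ω => le_iSup₂ (f := fun (t : ℕ) (s : Z) =>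
          ∫⁻ s', ENNReal.ofReal (y s') ∂(κ t s)) t (z t ω)
    _ = _ := by simp

theorem lintegral_wealth_le [IsProbabilityMeasure P] [∀ t, IsMarkovKernel (κ t)] (hz : IsMarkovProcess P ℱ κ z)
    (hy : Measurable y) (hR : 1 ≤ R) (hc : ∀ t, ∀ᵐ ω ∂P, 0 ≤ c t ω) (t : ℕ) :
    ∫⁻ ω, ENNReal.ofReal (wealth R a₀ y z c t ω) ∂P ≤
      ENNReal.ofReal (R ^ t) * (ENNReal.ofReal a₀ +
        t * ⨆ (t : ℕ) (s : Z), ∫⁻ s', ENNReal.ofReal (y s') ∂(κ t s)) := by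
  have hR0 : 0 ≤ R := by linarith
  set M := ⨆ (t : ℕ) (s : Z), ∫⁻ s', ENNReal.ofReal (y s') ∂(κ t s)
  induction t with
  | zero => simp [wealth]
  | succ t ih =>
    calc ∫⁻ ω, ENNReal.ofReal (wealth R a₀ y z c (t + 1) ω) ∂P
        ≤ ∫⁻ ω, (ENNReal.ofReal R * ENNReal.ofReal (wealth R a₀ y z c t ω) +
          ENNReal.ofReal (y (z (t + 1) ω))) ∂P := by
          refine lintegral_mono_ae ?_
          filter_upwards [hc t] with ω hω
          rw [wealth, ← ENNReal.ofReal_mul hR0]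
          refine ENNReal.ofReal_add_le.trans ?_
          gcongr
          linarith
      _ = ENNReal.ofReal R * ∫⁻ ω, ENNReal.ofReal (wealth R a₀ y z c t ω) ∂P +
          ∫⁻ ω, ENNReal.ofReal (y (z (t + 1) ω)) ∂P := by
          rw [lintegral_add_right _ (show Measurable fun ω => ENNReal.ofReal (y (z (t + 1) ω)) from
              (hy.comp (hz.measurable (t + 1))).ennreal_ofReal),
            lintegral_const_mul' _ _ ENNReal.ofReal_ne_top]
      _ ≤ ENNReal.ofReal R * (ENNReal.ofReal (R ^ t) * (ENNReal.ofReal a₀ + t * M)) +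
          ENNReal.ofReal (R ^ (t + 1)) * M := by
          gcongr
          refine (lintegral_income_le hz hy t).trans (le_mul_of_one_le_left zero_le ?_)
          rw [← ENNReal.ofReal_one]
          exact ENNReal.ofReal_le_ofReal (one_le_pow₀ hR)
      _ = _ := by
          rw [← mul_assoc, ← ENNReal.ofReal_mul hR0, ← pow_succ', ← mul_add]
          push_cast
          ring

/-- Utility lies below its tangent at `1`, and expected wealth grows at most like `R^t (a₀ + t M)`,
so the discounted sum converges because `βR < 1`. -/
theorem lintegral_posUtility_lt_top [IsProbabilityMeasure P] [∀ t, IsMarkovKernel (κ t)] (hu : UtilityAssumption u)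
    (hz : IsMarkovProcess P ℱ κ z) (hy : Measurable y) (hmean : BoundedConditionalMean κ y)
    (hβ : 0 < β) (hR : 1 ≤ R) (hβR : β * R < 1) (hc : IsFeasible P ℱ R a₀ y z c) :
    ∫⁻ ω, posUtility u β (fun s => c s ω) ∂P < ⊤ := by
  have hc0 : ∀ t, ∀ᵐ ω ∂P, 0 ≤ c t ω := fun t => (hc.2 t).mono fun _ h => h.1
  have hw := lintegral_wealth_le (a₀ := a₀) hz hy hR hc0
  unfold BoundedConditionalMean at hmean
  set M := ⨆ (t : ℕ) (s : Z), ∫⁻ s', ENNReal.ofReal (y s') ∂(κ t s)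
  have hm := hu.marginal_pos 1 one_pos
  have hβ1 : β < 1 := by nlinarith
  have hβR0 : 0 < β * R := by positivity
  unfold posUtility
  have hmeas : ∀ s, AEMeasurable (fun ω => ENNReal.ofReal (β ^ s) * (u (c s ω)).toENNReal) P :=
    fun s => (measurable_ereal_toENNReal.comp_aemeasurable
      (hu.aemeasurable_comp (hc.measurable s) (hc0 s))).const_mul _
  rw [lintegral_tsum hmeas]
  have hterm : ∀ s, ∫⁻ ω, ENNReal.ofReal (β ^ s) * (u (c s ω)).toENNReal ∂P ≤
      ENNReal.ofReal (β ^ s * |realUtility u 1| + marginal u 1 * (max a₀ 0 * (β * R) ^ s +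
        M.toReal * (s * (β * R) ^ s))) := by
    intro s
    rw [lintegral_const_mul' _ _ ENNReal.ofReal_ne_top]
    calc _ ≤ ENNReal.ofReal (β ^ s) * ∫⁻ ω, (ENNReal.ofReal |realUtility u 1| +
          ENNReal.ofReal (marginal u 1) * ENNReal.ofReal (wealth R a₀ y z c s ω)) ∂P := by
          refine mul_le_mul le_rfl (lintegral_mono_ae ?_) zero_le zero_le
          filter_upwards [hc.2 s] with ω hω
          exact hu.toENNReal_le hω.1 hω.2
      _ ≤ ENNReal.ofReal (β ^ s) * (ENNReal.ofReal |realUtility u 1| +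
          ENNReal.ofReal (marginal u 1) * (ENNReal.ofReal (R ^ s) * (ENNReal.ofReal a₀ +
            s * M))) := by
          rw [lintegral_add_left measurable_const, lintegral_const_mul' _ _ ENNReal.ofReal_ne_top]
          simp only [lintegral_const, measure_univ, mul_one]
          gcongr
          exact hw s
      _ = _ := by
          have h1 : ENNReal.ofReal a₀ + s * M = ENNReal.ofReal (max a₀ 0 + s * M.toReal) := by
            rw [ENNReal.ofReal_add (le_max_right _ _) (by positivity),
              ENNReal.ofReal_mul (by positivity), ENNReal.ofReal_natCast,
              ENNReal.ofReal_toReal hmean.ne]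
            congr 1
            rcases max_cases a₀ 0 with h | h
            · rw [h.1]
            · rw [h.1, ENNReal.ofReal_zero, ENNReal.ofReal_of_nonpos h.2.le]
          have hR0 : 0 < R := by linarith
          rw [h1, ← ENNReal.ofReal_mul (by positivity), ← ENNReal.ofReal_mul hm.le,
            ← ENNReal.ofReal_add (abs_nonneg _) (by positivity),
            ← ENNReal.ofReal_mul (by positivity)]
          congr 1
          rw [mul_pow]
          ring
  refine (ENNReal.tsum_le_tsum hterm).trans_lt (lt_top_iff_ne_top.2 ?_)
  refine Summable.tsum_ofReal_ne_top ?_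
  have h2 := summable_geometric_of_lt_one hβR0.le hβR
  have h3 := summable_pow_mul_geometric_of_norm_lt_one 1 (r := β * R)
    (by rwa [Real.norm_of_nonneg hβR0.le])
  simp only [pow_one] at h3
  exact ((summable_geometric_of_lt_one hβ.le hβ1).mul_right _).add
    (((h2.mul_left _).add (h3.mul_left _)).mul_left _)

theorem measurable_wealth (hc : Adapted ℱ c) (hz : IsMarkovProcess P ℱ κ z) (hy : Measurable y)
    (t : ℕ) : Measurable[ℱ t] (wealth R a₀ y z c t) := by
  induction t with
  | zero => exact measurable_const
  | succ t ih =>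
    exact (((ih.sub (hc t)).const_mul R).mono (ℱ.mono t.le_succ) le_rfl).add
      (hy.comp (hz.1 (t + 1)))

/-- Deviating on this event is feasible and raises utility there by a fixed `g > 0`. Expected
utilities being finite, optimality forces `g * P E = 0`. -/
theorem IsSolution.measure_eq_zero [IsProbabilityMeasure P] [∀ t, IsMarkovKernel (κ t)] (hu : UtilityAssumption u)
    (hz : IsMarkovProcess P ℱ κ z) (hy : Measurable y) (hy0 : ∀ s, 0 ≤ y s)
    (hmean : BoundedConditionalMean κ y) (hβ : 0 < β) (hR : 1 ≤ R) (hβR : β * R < 1)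
    (hfin : R = 1 → FiniteValueWithoutIncome u β R) (ha₀ : 0 < a₀)
    (hc : IsSolution P ℱ u β R a₀ y z c) {x q w : ℝ} (hx : 0 < x) (hxq : x < q)
    (hpath : HasFinancedPath u β R q w) (t : ℕ) :
    P {ω | c t ω < x ∧ w ≤ wealth R a₀ y z c t ω} = 0 := by
  obtain ⟨e, rfl, he, hm, hfe⟩ := hpath
  set E : Set Ω := {ω | c t ω < x ∧ w ≤ wealth R a₀ y z c t ω}
  have hR0 : 0 < R := by linarith
  have hE : MeasurableSet[ℱ t] E :=
    MeasurableSet.inter ((hc.1.1 t) measurableSet_Iio)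
      (measurable_wealth hc.1.1 hz hy t measurableSet_Ici)
  have hE' : MeasurableSet E := ℱ.le t _ hE
  have hall : ∀ᵐ ω ∂P, ∀ s, 0 ≤ c s ω ∧ c s ω ≤ wealth R a₀ y z c s ω := ae_all_iff.2 hc.1.2
  set c' := deviation R E t e c
  have hc' : IsFeasible P ℱ R a₀ y z c' := by
    refine ⟨fun s => measurable_deviation hc.1.1 hE s, fun s => ?_⟩
    filter_upwards [hall] with ω hω
    by_cases hωE : ω ∈ E
    · exact deviation_feasible hR0.le hy0 hω (fun n => (he n).le) hωE (hωE.1.le.trans hxq.le)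
        (hfe.mono hωE.2) s
    · rw [wealth_deviation, debt_of_notMem hωE, sub_zero]
      simp only [c', deviation_of_notMem hωE]
      exact hω s
  set g := ENNReal.ofReal (β ^ t * (realUtility u (e 0) + marginal u (e 0) * (x - e 0) -
    realUtility u x)) with hg
  have hg0 : 0 < g := ENNReal.ofReal_pos.2
    (mul_pos (by positivity) (sub_pos.2 (hu.lt_tangent (he 0) hx hxq.ne')))
  have hpath : ∀ᵐ ω ∂P, posUtility u β (fun s => c s ω) + negUtility u β (fun s => c' s ω) +
      E.indicator (fun _ => g) ω ≤
      posUtility u β (fun s => c' s ω) + negUtility u β (fun s => c s ω) := by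
    filter_upwards [hall] with ω hω
    by_cases hωE : ω ∈ E
    · rw [Set.indicator_of_mem hωE]
      exact hu.utility_deviation hβ hR0 (fun s => (hω s).1) he hm hωE hωE.1.le hx hxq.le
    · rw [Set.indicator_of_notMem hωE, add_zero]
      simp only [c', deviation_of_notMem hωE]
      exact le_rfl
  have hc0 : ∀ t, ∀ᵐ ω ∂P, 0 ≤ c t ω := fun t => (hc.1.2 t).mono fun _ h => h.1
  have hN := hc.lintegral_negUtility_lt_top hu hβ hR hβR hy0 hfin ha₀
  have hP := lintegral_posUtility_lt_top hu hz hy hmean hβ hR hβR hc.1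
  have hP' := lintegral_posUtility_lt_top hu hz hy hmean hβ hR hβR hc'
  have hle := hc.2 c' hc'
  have hint : ∫⁻ ω, posUtility u β (fun s => c s ω) ∂P + ∫⁻ ω, negUtility u β (fun s => c' s ω) ∂P
      + g * P E ≤ ∫⁻ ω, posUtility u β (fun s => c' s ω) ∂P +
        ∫⁻ ω, negUtility u β (fun s => c s ω) ∂P := by
    rw [← lintegral_indicator_const hE',
      ← lintegral_add_right' _ (hu.aemeasurable_negUtility hc.1.measurable hc0)]
    exact (add_le_add_left (le_lintegral_add _ _) _).trans
      ((le_lintegral_add _ _).trans (lintegral_mono_ae hpath))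
  rw [lifetimeUtility_eq, lifetimeUtility_eq] at hle
  generalize ∫⁻ ω, posUtility u β (fun s => c s ω) ∂P = p at *
  generalize ∫⁻ ω, posUtility u β (fun s => c' s ω) ∂P = p' at *
  generalize ∫⁻ ω, negUtility u β (fun s => c s ω) ∂P = n at *
  generalize ∫⁻ ω, negUtility u β (fun s => c' s ω) ∂P = n' at *
  have hfin' : p + n' + g * P E < ⊤ := hint.trans_lt (ENNReal.add_lt_top.2 ⟨hP', hN⟩)
  have hn' : n' < ⊤ := (le_add_self.trans le_self_add).trans_lt hfin'
  have hle2 : p' + n ≤ p + n' := by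
    lift p to NNReal using hP.ne
    lift p' to NNReal using hP'.ne
    lift n to NNReal using hN.ne
    lift n' to NNReal using hn'.ne
    simp only [EReal.coe_nnreal_eq_coe_real, ← EReal.coe_sub, EReal.coe_le_coe_iff] at hle
    norm_cast
    rw [← NNReal.coe_le_coe]
    push_cast
    linarith
  have h0 : g * P E ≤ 0 := by
    have hpn : p + n' ≠ ⊤ := (ENNReal.add_lt_top.2 ⟨hP, hn'⟩).ne
    refine (ENNReal.add_le_add_iff_left hpn).1 ?_
    rw [add_zero]
    exact hint.trans hle2
  exact (mul_eq_zero.1 (le_antisymm h0 zero_le)).resolve_left hg0.ne'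

/-- Contraction at high wealth levels when the gross return is at least one. -/
theorem contractionProperty_of_one_le [IsProbabilityMeasure P] [∀ t, IsMarkovKernel (κ t)] (hu : UtilityAssumption u)
    (hb : BoundedRiskAversion u) (hz : IsMarkovProcess P ℱ κ z) (hy : Measurable y)
    (hy0 : ∀ s, 0 ≤ y s) (hmean : BoundedConditionalMean κ y) (hβ : 0 < β) (hR : 1 ≤ R)
    (hβR : β * R < 1) (hfin : R = 1 → FiniteValueWithoutIncome u β R) {ρ : ℝ}
    (hρ : contractionBound u β R < ρ) (hρ1 : ρ < 1) :
    ContractionProperty P ℱ u β R y z ρ := by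
  have hR0 : 0 < R := by linarith
  have hβ1 : β < 1 := by nlinarith
  have hfin' : FiniteValueWithoutIncome u β R := by
    rcases hR.eq_or_lt with h | h
    · exact hfin h.symm
    · exact finiteValueWithoutIncome_of_one_lt hβ.le hβ1 h
  -- The slack between `ρ'` and `ρ` absorbs the constant `K`: `K + q / k' ≤ q / k` once `q ≥ q₀`.
  obtain ⟨ρ', hρ', hρρ'⟩ := exists_between hρ
  obtain ⟨K, hK, hpath⟩ := hu.exists_hasFinancedPath hb hβ hR hβR hfin' hρ' (hρρ'.trans hρ1)
  set k := 1 - ρ / R with hk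
  set k' := 1 - ρ' / R
  have hk0 : 0 < k := by
    rw [hk, sub_pos, div_lt_one hR0]
    linarith
  have hkk : k < k' := sub_lt_sub_left (div_lt_div_of_pos_right hρρ' hR0) _
  have hk0' : 0 < k' := hk0.trans hkk
  have hδ : 0 < 1 / k - 1 / k' := sub_pos.2 (one_div_lt_one_div_of_lt hk0 hkk)
  set q₀ := K / (1 / k - 1 / k') + 1 with hq₀
  have hq₀0 : 0 < q₀ := by positivity
  have hq : ∀ q, q₀ ≤ q → K + q / k' ≤ q / k := fun q hq => by
    have h1 : K / (1 / k - 1 / k') ≤ q := by linarith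
    rw [div_le_iff₀ hδ] at h1
    have h2 : q * (1 / k - 1 / k') = q / k - q / k' := by ring
    linarith
  refine ⟨(q₀ + 1) / k, by positivity, fun a₀ c ha₀ hc => ?_⟩
  -- Rational levels make a countable family of null events, later compared with the random
  -- consumption and wealth.
  have hall : ∀ᵐ ω ∂P, ∀ t : ℕ, ∀ x q : ℚ, 0 < (x : ℝ) → (x : ℝ) < q → q₀ ≤ q →
      ¬ (c t ω < x ∧ (q : ℝ) / k ≤ wealth R a₀ y z c t ω) := by
    refine ae_all_iff.2 fun t => ae_all_iff.2 fun x => ae_all_iff.2 fun q => ?_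
    by_cases h : 0 < (x : ℝ) ∧ (x : ℝ) < q ∧ q₀ ≤ q
    · obtain ⟨h1, h2, h3⟩ := h
      obtain ⟨e, he1, he2, he3, he4⟩ := hpath q (h1.trans h2)
      have := hc.measure_eq_zero hu hz hy hy0 hmean hβ hR hβR hfin ha₀ h1 h2
        ⟨e, he1, he2, he3, he4.mono (hq q h3)⟩ t
      have h4 : ∀ᵐ ω ∂P, ¬ (c t ω < x ∧ (q : ℝ) / k ≤ wealth R a₀ y z c t ω) :=
        measure_eq_zero_iff_ae_notMem.1 this
      filter_upwards [h4] with ω hω _ _ _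
      exact hω
    · exact Eventually.of_forall fun ω h1 h2 h3 => absurd ⟨h1, h2, h3⟩ h
  filter_upwards [hall] with ω hω t hA
  rw [div_le_iff₀ hk0] at hA
  have hck : k * wealth R a₀ y z c t ω ≤ c t ω := by
    by_contra! hlt
    obtain ⟨x, hx1, hx2⟩ := exists_rat_btwn
      (max_lt hlt (show q₀ < k * wealth R a₀ y z c t ω by linarith))
    obtain ⟨q, hq1, hq2⟩ := exists_rat_btwn hx2
    rw [max_lt_iff] at hx1
    refine hω t x q (hq₀0.trans hx1.2) hq1 (hx1.2.le.trans hq1.le) ⟨hx1.1, ?_⟩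
    rw [div_le_iff₀ hk0]
    linarith
  rw [wealth]
  have h1 : R * (wealth R a₀ y z c t ω - c t ω) ≤
      R * (wealth R a₀ y z c t ω - k * wealth R a₀ y z c t ω) := by gcongr
  have h2 : R * (wealth R a₀ y z c t ω - k * wealth R a₀ y z c t ω) =
      ρ * wealth R a₀ y z c t ω := by
    rw [hk]
    field_simp
    ring
  linarith

end ExpectedUtility

/-! ### Tails -/

section Tails

variable {Ω Z : Type*} {mΩ : MeasurableSpace Ω} {P : Measure Ω}

/-- The larger of the initial moment and the supremum of the forcing moments is preserved by the
convex combination. -/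
theorem iSup_lintegral_lt_top {ψ χ : ℕ → Ω → ℝ} {r : ℝ} (hr0 : 0 ≤ r) (hr1 : r ≤ 1)
    (hχ : ∀ t, Measurable (χ t))
    (hstep : ∀ t, ∀ᵐ ω ∂P, ψ (t + 1) ω ≤ r * ψ t ω + (1 - r) * χ t ω)
    (hzero : ∫⁻ ω, ENNReal.ofReal (ψ 0 ω) ∂P < ⊤)
    (hsup : (⨆ t, ∫⁻ ω, ENNReal.ofReal (χ t ω) ∂P) < ⊤) :
    (⨆ t, ∫⁻ ω, ENNReal.ofReal (ψ t ω) ∂P) < ⊤ := by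
  set C := ⨆ t, ∫⁻ ω, ENNReal.ofReal (χ t ω) ∂P
  set K := max (∫⁻ ω, ENNReal.ofReal (ψ 0 ω) ∂P) C
  refine lt_of_le_of_lt (iSup_le fun t => ?_) (max_lt hzero hsup : K < ⊤)
  induction t with
  | zero => exact le_max_left _ _
  | succ t ih =>
    calc ∫⁻ ω, ENNReal.ofReal (ψ (t + 1) ω) ∂P
        ≤ ∫⁻ ω, (ENNReal.ofReal r * ENNReal.ofReal (ψ t ω) +
            ENNReal.ofReal (1 - r) * ENNReal.ofReal (χ t ω)) ∂P := by
          refine lintegral_mono_ae ?_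
          filter_upwards [hstep t] with ω hω
          rw [← ENNReal.ofReal_mul hr0, ← ENNReal.ofReal_mul (sub_nonneg.2 hr1)]
          exact (ENNReal.ofReal_le_ofReal hω).trans ENNReal.ofReal_add_le
      _ = ENNReal.ofReal r * ∫⁻ ω, ENNReal.ofReal (ψ t ω) ∂P +
            ENNReal.ofReal (1 - r) * ∫⁻ ω, ENNReal.ofReal (χ t ω) ∂P := by
          rw [lintegral_add_right _ ((hχ t).ennreal_ofReal.const_mul _),
            lintegral_const_mul' _ _ ENNReal.ofReal_ne_top,
            lintegral_const_mul' _ _ ENNReal.ofReal_ne_top]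
      _ ≤ ENNReal.ofReal r * K + ENNReal.ofReal (1 - r) * K := by
          gcongr
          exact (le_iSup (fun t => ∫⁻ ω, ENNReal.ofReal (χ t ω) ∂P) t).trans (le_max_right _ _)
      _ = K := by
          rw [← add_mul, ← ENNReal.ofReal_add hr0 (sub_nonneg.2 hr1), add_sub_cancel,
            ENNReal.ofReal_one, one_mul]

theorem iSup_lintegral_affine_lt_top [IsProbabilityMeasure P] {f : ℕ → Ω → ℝ} {k l : ℝ}
    (hl : 0 ≤ l) (hsup : (⨆ t, ∫⁻ ω, ENNReal.ofReal (f t ω) ∂P) < ⊤) :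
    (⨆ t, ∫⁻ ω, ENNReal.ofReal (k + l * f t ω) ∂P) < ⊤ := by
  refine lt_of_le_of_lt (iSup_le fun t => ?_) (ENNReal.add_lt_top.2
    ⟨ENNReal.ofReal_lt_top (r := k), ENNReal.mul_lt_top (ENNReal.ofReal_lt_top (r := l)) hsup⟩)
  calc _ ≤ ∫⁻ ω, (ENNReal.ofReal k + ENNReal.ofReal l * ENNReal.ofReal (f t ω)) ∂P := by
        refine lintegral_mono fun ω => ?_
        rw [← ENNReal.ofReal_mul hl]
        exact ENNReal.ofReal_add_le
    _ = ENNReal.ofReal k + ENNReal.ofReal l * ∫⁻ ω, ENNReal.ofReal (f t ω) ∂P := by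
        rw [lintegral_add_left measurable_const, lintegral_const_mul' _ _ ENNReal.ofReal_ne_top]
        simp
    _ ≤ _ := by
        gcongr
        exact le_iSup (fun t => ∫⁻ ω, ENNReal.ofReal (f t ω) ∂P) t

theorem rpow_add_le_two_mul {s B x : ℝ} (hs : 0 ≤ s) (hB : 0 ≤ B) (hx : 0 ≤ x) :
    (B + x) ^ s ≤ 2 ^ s * (B ^ s + x ^ s) := by
  have h1 := Real.rpow_nonneg hB s
  have h2 := Real.rpow_nonneg hx s
  have h3 : (0 : ℝ) < 2 ^ s := by positivity
  rcases le_total B x with h | h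
  · calc (B + x) ^ s ≤ (2 * x) ^ s := Real.rpow_le_rpow (by linarith) (by linarith) hs
      _ = 2 ^ s * x ^ s := Real.mul_rpow (by norm_num) hx
      _ ≤ _ := by gcongr; linarith
  · calc (B + x) ^ s ≤ (2 * B) ^ s := Real.rpow_le_rpow (by linarith) (by linarith) hs
      _ = 2 ^ s * B ^ s := Real.mul_rpow (by norm_num) hB
      _ ≤ _ := by gcongr; linarith

/-- Powers of an affine contraction are controlled by an affine contraction of the powers. -/
theorem exists_rpow_contraction {ρ B s : ℝ} (hρ0 : 0 < ρ) (hρ1 : ρ < 1) (hB : 0 ≤ B)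
    (hs : 0 ≤ s) : ∃ r k l : ℝ, 0 ≤ r ∧ r ≤ 1 ∧ 0 ≤ l ∧ ∀ a x : ℝ, 0 ≤ a → 0 ≤ x →
      (ρ * a + (B + x)) ^ s ≤ r * a ^ s + (1 - r) * (k + l * x ^ s) := by
  rcases hs.eq_or_lt with rfl | hs0
  · exact ⟨0, 1, 0, le_rfl, zero_le_one, le_rfl, fun a x _ _ => by simp⟩
  · rcases le_total 1 s with h1 | h1
    -- For `s ≥ 1`, convexity with weights `ρ` and `1 - ρ`; below, for `s ≤ 1`, subadditivity of the
    -- power with `r = ρ ^ s`.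
    · set m := (2 / (1 - ρ)) ^ s with hm
      have hρ : 0 < 1 - ρ := by linarith
      refine ⟨ρ, m * B ^ s, m, hρ0.le, hρ1.le, by positivity, fun a x ha hx => ?_⟩
      have hX : 0 ≤ (B + x) / (1 - ρ) := by positivity
      have hconv := (convexOn_rpow h1).2 (x := a) (y := (B + x) / (1 - ρ)) ha hX hρ0.le hρ.le
        (by ring)
      simp only [smul_eq_mul] at hconv
      rw [mul_div_cancel₀ _ hρ.ne'] at hconv
      refine hconv.trans (add_le_add le_rfl (mul_le_mul_of_nonneg_left ?_ hρ.le))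
      rw [hm, Real.div_rpow (by positivity) hρ.le, Real.div_rpow (by positivity) hρ.le]
      have h2 := rpow_add_le_two_mul hs hB hx
      have h3 : 0 < (1 - ρ) ^ s := Real.rpow_pos_of_pos hρ s
      calc _ ≤ 2 ^ s * (B ^ s + x ^ s) / (1 - ρ) ^ s := by gcongr
        _ = _ := by ring
    · have hr : 0 < 1 - ρ ^ s := sub_pos.2 (Real.rpow_lt_one hρ0.le hρ1 hs0)
      refine ⟨ρ ^ s, 2 ^ s * B ^ s / (1 - ρ ^ s), 2 ^ s / (1 - ρ ^ s), by positivity,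
        by linarith, by positivity, fun a x ha hx => ?_⟩
      have h4 : (ρ * a + (B + x)) ^ s ≤ (ρ * a) ^ s + (B + x) ^ s :=
        Real.rpow_add_le_add_rpow (by positivity) (by positivity) hs h1
      rw [Real.mul_rpow hρ0.le ha] at h4
      have h5 := rpow_add_le_two_mul hs hB hx
      have h6 : (1 - ρ ^ s) * (2 ^ s * B ^ s / (1 - ρ ^ s) + 2 ^ s / (1 - ρ ^ s) * x ^ s) =
          2 ^ s * (B ^ s + x ^ s) := by
        field_simp
      linarith

section Wealth

variable [IsProbabilityMeasure P] {R a₀ ρ B : ℝ} {y : Z → ℝ} {z : ℕ → Ω → Z}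
  {c : ℕ → Ω → ℝ}

theorem uniformlyLightTailed_wealth (hρ0 : 0 < ρ) (hρ1 : ρ < 1)
    (hm : ∀ t, Measurable fun ω => y (z (t + 1) ω))
    (hstep : ∀ t, ∀ᵐ ω ∂P, wealth R a₀ y z c (t + 1) ω ≤
      ρ * wealth R a₀ y z c t ω + (B + y (z (t + 1) ω)))
    (h : UniformlyLightTailed P fun (t : ℕ) ω => y (z (t + 1) ω)) :
    UniformlyLightTailed P (wealth R a₀ y z c) := by
  obtain ⟨s, hs, hsup⟩ := h
  have hρ : 0 < 1 - ρ := by linarith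
  -- With this rate the exponent is the convex combination of `s (1 - ρ) a` and `s (B + y)` with
  -- weights `ρ` and `1 - ρ`.
  refine ⟨s * (1 - ρ), by positivity, ?_⟩
  refine iSup_lintegral_lt_top (χ := fun t ω => 0 + Real.exp (s * B) *
    Real.exp (s * y (z (t + 1) ω))) hρ0.le hρ1.le ?_ ?_ ?_ ?_
  · intro t
    exact measurable_const.add (((hm t).const_mul s).exp.const_mul _)
  · intro t
    filter_upwards [hstep t] with ω hω
    have hconv := convexOn_exp.2 (Set.mem_univ (s * (1 - ρ) * wealth R a₀ y z c t ω))
      (Set.mem_univ (s * (B + y (z (t + 1) ω)))) hρ0.le hρ.le (by ring)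
    simp only [smul_eq_mul] at hconv
    rw [zero_add, ← Real.exp_add, ← mul_add]
    refine le_trans (Real.exp_le_exp.2 ?_) hconv
    have := mul_le_mul_of_nonneg_left hω (mul_pos hs hρ).le
    linarith
  · simp [wealth]
  · exact iSup_lintegral_affine_lt_top (Real.exp_pos _).le hsup

theorem polynomialDecayRate_le_wealth (hρ0 : 0 < ρ) (hρ1 : ρ < 1) (hB : 0 ≤ B)
    (hy : ∀ s, 0 ≤ y s) (hm : ∀ t, Measurable fun ω => y (z (t + 1) ω))
    (hpos : ∀ t, ∀ᵐ ω ∂P, 0 ≤ wealth R a₀ y z c t ω)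
    (hstep : ∀ t, ∀ᵐ ω ∂P, wealth R a₀ y z c (t + 1) ω ≤
      ρ * wealth R a₀ y z c t ω + (B + y (z (t + 1) ω))) :
    polynomialDecayRate P (fun (t : ℕ) ω => y (z (t + 1) ω)) ≤
      polynomialDecayRate P (wealth R a₀ y z c) := by
  refine sSup_le_sSup ?_
  rintro _ ⟨s, hs, rfl, hsup⟩
  refine ⟨s, hs, rfl, ?_⟩
  obtain ⟨r, k, l, hr0, hr1, hl, hrpow⟩ := exists_rpow_contraction hρ0 hρ1 hB hs
  refine iSup_lintegral_lt_top (χ := fun t ω => k + l * (max (y (z (t + 1) ω)) 0) ^ s)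
    hr0 hr1 ?_ ?_ ?_ ?_
  · intro t
    exact measurable_const.add ((((hm t).max measurable_const).pow_const s).const_mul l)
  · intro t
    filter_upwards [hstep t, hpos t, hpos (t + 1)] with ω h1 h2 h3
    rw [max_eq_left h2, max_eq_left h3, max_eq_left (hy _)]
    exact (Real.rpow_le_rpow h3 h1 hs).trans (hrpow _ _ h2 (hy _))
  · simp [wealth]
  · exact iSup_lintegral_affine_lt_top hl hsup

end Wealth

end Tails

end IncomeFluctuation

theorem proposition3 {Ω Z : Type*} {mΩ : MeasurableSpace Ω} [MeasurableSpace Z]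
    (P : Measure Ω) [IsProbabilityMeasure P] (ℱ : Filtration ℕ mΩ)
    (κ : ℕ → Kernel Z Z) [∀ t, IsMarkovKernel (κ t)] (z : ℕ → Ω → Z) (y : Z → ℝ)
    (u : ℝ → EReal) (β R : ℝ) (hβ : 0 < β) (hR : 0 < R) (hβR : β * R < 1)
    (hu : IncomeFluctuation.UtilityAssumption u)
    (hbrra : IncomeFluctuation.BoundedRiskAversion u)
    (hy : Measurable y) (hy_nonneg : ∀ s, 0 ≤ y s)
    (hz : IncomeFluctuation.IsMarkovProcess P ℱ κ z)
    (hmean : IncomeFluctuation.BoundedConditionalMean κ y)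
    (hfin : R = 1 → IncomeFluctuation.FiniteValueWithoutIncome u β R) :
    -- contraction at high wealth levels, with the possible coefficients
    (∃ ρ ∈ Set.Ioo (0 : ℝ) 1, IncomeFluctuation.ContractionProperty P ℱ u β R y z ρ) ∧
    (R < 1 → IncomeFluctuation.ContractionProperty P ℱ u β R y z R) ∧
    (1 ≤ R → ∀ ρ ∈ Set.Ioo (IncomeFluctuation.contractionBound u β R) 1,
      IncomeFluctuation.ContractionProperty P ℱ u β R y z ρ) ∧
    -- tails of the wealth process of any solution
    ∀ (a₀ : ℝ) (c : ℕ → Ω → ℝ), 0 < a₀ →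
      IncomeFluctuation.IsSolution P ℱ u β R a₀ y z c →
      (IncomeFluctuation.UniformlyLightTailed P (fun (t : ℕ) ω => y (z (t + 1) ω)) →
        IncomeFluctuation.UniformlyLightTailed P
          (IncomeFluctuation.wealth R a₀ y z c)) ∧
      IncomeFluctuation.polynomialDecayRate P (fun (t : ℕ) ω => y (z (t + 1) ω)) ≤
        IncomeFluctuation.polynomialDecayRate P (IncomeFluctuation.wealth R a₀ y z c) := by
  have hβR0 : 0 < β * R := by positivity
  have hge : 1 ≤ R → ∀ ρ ∈ Set.Ioo (IncomeFluctuation.contractionBound u β R) 1,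
      IncomeFluctuation.ContractionProperty P ℱ u β R y z ρ := fun h ρ hρ =>
    IncomeFluctuation.contractionProperty_of_one_le hu hbrra hz hy hy_nonneg hmean hβ h hβR hfin
      hρ.1 hρ.2
  have hex : ∃ ρ ∈ Set.Ioo (0 : ℝ) 1,
      IncomeFluctuation.ContractionProperty P ℱ u β R y z ρ := by
    rcases lt_or_ge R 1 with h | h
    · exact ⟨R, ⟨hR, h⟩, IncomeFluctuation.contractionProperty_of_lt_one hR.le⟩
    · obtain ⟨ρ, hρ, hρ1⟩ := exists_between (hu.contractionBound_lt_one hβR0 hβR)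
      exact ⟨ρ, ⟨(IncomeFluctuation.contractionBound_nonneg hβR0).trans_lt hρ, hρ1⟩,
        hge h ρ ⟨hρ, hρ1⟩⟩
  refine ⟨hex, fun _ => IncomeFluctuation.contractionProperty_of_lt_one hR.le, hge,
    fun a₀ c ha₀ hc => ?_⟩
  obtain ⟨ρ, ⟨hρ0, hρ1⟩, A, hA, hcontr⟩ := hex
  -- Below the threshold `A`, next wealth is at most `R * A` plus income, so this constant makes the
  -- contraction valid at every wealth level.
  have hB : 0 ≤ R * A := by positivity
  have hm : ∀ t, Measurable fun ω => y (z (t + 1) ω) := fun t => hy.comp (hz.measurable (t + 1))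
  have hpos : ∀ t, ∀ᵐ ω ∂P, 0 ≤ IncomeFluctuation.wealth R a₀ y z c t ω := fun t =>
    (hc.1.2 t).mono fun ω h => h.1.trans h.2
  have hstep : ∀ t, ∀ᵐ ω ∂P, IncomeFluctuation.wealth R a₀ y z c (t + 1) ω ≤
      ρ * IncomeFluctuation.wealth R a₀ y z c t ω + (R * A + y (z (t + 1) ω)) := by
    intro t
    filter_upwards [hcontr a₀ c ha₀ hc, hc.1.2 t] with ω h1 h2
    rcases le_total A (IncomeFluctuation.wealth R a₀ y z c t ω) with h | h
    · linarith [h1 t h]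
    · have h3 : R * (IncomeFluctuation.wealth R a₀ y z c t ω - c t ω) ≤ R * A :=
        mul_le_mul_of_nonneg_left (by linarith) hR.le
      have h4 := mul_nonneg hρ0.le (h2.1.trans h2.2)
      rw [IncomeFluctuation.wealth]
      linarith
  exact ⟨IncomeFluctuation.uniformlyLightTailed_wealth hρ0 hρ1 hm hstep,
    IncomeFluctuation.polynomialDecayRate_le_wealth hρ0 hρ1 hB hy_nonneg hm hpos hstep⟩
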